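/- **Corollary (random walk with constant costs).** Let $X_1,X_2,\dots$ be i.i.d. real random variables with $P(X_1>0)>0$, let $S_n=\sum_{i=1}^nX_i$, and for $y\in\mathbb R$ let $Y^y_n=y+S_n$ be the random walk started in $y$. Let $\gamma:\mathbb R\to\mathbb R$ be non-decreasing and let $h\equiv c$ with a constant $c>0$. For a stopping time $\tau$ (with values in $\mathbb N_0\cup\{\infty\}$, with respect to the filtration generated by the walk) the expected payoff is $E\big(\gamma(Y^y_\tau)-c\,\tau\big)$, the payoff being $-\infty$ on $\{\tau=\infty\}$; the value $V(y)$ is its supremum over all stopping times, and $\tau$ is called optimal for the start $y$ if it attains $V(y)$. Assume that for every $y\in\mathbb R$ $$E\Big(\sup_{n\ge0}\big(\gamma(Y^y_n)-c\,n\big)\Big)<\infty\qquad\text{and}\qquad \gamma(Y^y_n)-c\,n\to-\infty\ \text{ almost surely.}$$ Let $\tau^+=\inf\{n\ge 0: S_n>0\}$, assume $E(\tau^+)<\infty$, and put $$f(y)=\frac{E\big(\gamma(y+S_{\tau^+})-c\,\tau^+\big)-\gamma(y)}{E(\tau^+)},\qquad y\in\mathbb R.$$ Let $$\bar x:=\inf\big\{y\in\mathbb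 R:\ E\big(\gamma(y)-\gamma(y+S_{\tau^+})\big)\ \ge\ -c\,E(\tau^+)\big\},$$ suppose that $\bar x$ is a real number (the set is non-empty and bounded below), and suppose that $\gamma$ is concave on $[\bar x,\infty)$. Then: * if $f(\bar x)\le 0$, then for every start $y\in\mathbb R$ the time $\inf\{n\ge0: Y^y_n\ge\bar x\}$ is an optimal stopping time; * if $f(\bar x)>0$, then for every start $y\in\mathbb R$ the time $\inf\{n\ge0: Y^y_n>\bar x\}$ is an optimal stopping time. -/

import Mathlib

open MeasureTheory ProbabilityTheory Filter Topology
open scoped ENNReal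

namespace WalkStopping

variable {Ω : Type*} [MeasurableSpace Ω]

/-- The partial sums `S_n`. The increments are numbered from `0`: the variable `X i` is the
increment of the walk from time `i` to time `i + 1`. -/
def walk (X : ℕ → Ω → ℝ) (n : ℕ) (ω : Ω) : ℝ :=
  ∑ i ∈ Finset.range n, X i ω

lemma measurable_walk {X : ℕ → Ω → ℝ} (hX : ∀ i, Measurable (X i)) (n : ℕ) :
    Measurable (walk X n) :=
  Finset.measurable_fun_sum _ fun i _ => hX i

/-- The random walk started in `y`, namely `Y_n = y + S_n`. -/
def chain (X : ℕ → Ω → ℝ) (y : ℝ) (n : ℕ) (ω : Ω) : ℝ :=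
  y + walk X n ω

/-- The filtration generated by the walk (for each `y`, also the one generated by
`chain X y`). -/
noncomputable def walkFiltration (X : ℕ → Ω → ℝ) (hX : ∀ i, Measurable (X i)) :
    Filtration ℕ (inferInstance : MeasurableSpace Ω) :=
  Filtration.natural (walk X) fun n => (measurable_walk hX n).stronglyMeasurable

/-- The payoff `γ(Y_n) - ∑_{i=1}^n h(Y_i)` of stopping at time `n`, for the start `y`. -/
def payoff (γ h : ℝ → ℝ) (X : ℕ → Ω → ℝ) (y : ℝ) (n : ℕ) (ω : Ω) : ℝ :=
  γ (chain X y n ω) - ∑ i ∈ Finset.Icc 1 n, h (chain X y i ω)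

/-- The payoff of the random time `τ`; it is `-∞` where one never stops. -/
noncomputable def stoppedPayoff (γ h : ℝ → ℝ) (X : ℕ → Ω → ℝ) (y : ℝ) (τ : Ω → WithTop ℕ)
    (ω : Ω) : EReal :=
  match τ ω with
  | ⊤ => ⊥
  | (n : ℕ) => (payoff γ h X y n ω : EReal)

/-- Expectation of an extended real random variable, `E Z = E Z⁺ - E Z⁻`. (Where both parts are
infinite the value is `-∞`; this does not occur for payoffs under the integrability assumption
in `StandardAssumption`.) -/
noncomputable def expectation (P : Measure Ω) (Z : Ω → EReal) : EReal :=
  ((∫⁻ ω, (Z ω).toENNReal ∂P : ℝ≥0∞) : EReal) - ((∫⁻ ω, (-Z ω).toENNReal ∂P : ℝ≥0∞) : EReal)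

/-- The value function `V(y)`: the supremum of the expected payoffs over all stopping times. -/
noncomputable def value (P : Measure Ω) (γ h : ℝ → ℝ) (X : ℕ → Ω → ℝ)
    (hX : ∀ i, Measurable (X i)) (y : ℝ) : EReal :=
  ⨆ (τ : Ω → WithTop ℕ) (_ : IsStoppingTime (walkFiltration X hX) τ),
    expectation P (stoppedPayoff γ h X y τ)

/-- `τ` is an optimal stopping time for the start `y`. -/
def IsOptimal (P : Measure Ω) (γ h : ℝ → ℝ) (X : ℕ → Ω → ℝ)
    (hX : ∀ i, Measurable (X i)) (y : ℝ) (τ : Ω → WithTop ℕ) : Prop :=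
  IsStoppingTime (walkFiltration X hX) τ ∧
    expectation P (stoppedPayoff γ h X y τ) = value P γ h X hX y

/-- For every start `y`, `E_y (sup_n (γ(Y_n) - ∑_{i=1}^n h(Y_i))) < ∞`, and
`γ(Y_n) - ∑_{i=1}^n h(Y_i) → -∞` almost surely. -/
def StandardAssumption (P : Measure Ω) (γ h : ℝ → ℝ) (X : ℕ → Ω → ℝ) : Prop :=
  (∀ y : ℝ, expectation P (fun ω => ⨆ n : ℕ, (payoff γ h X y n ω : EReal)) < ⊤) ∧
    ∀ y : ℝ, ∀ᵐ ω ∂P, Tendsto (fun n : ℕ => payoff γ h X y n ω) atTop atBot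

/-- The first ascending ladder time `τ⁺ = inf {n | S_n > 0} = inf {n | Y_n > Y_0}`. -/
noncomputable def ladderTime (X : ℕ → Ω → ℝ) : Ω → WithTop ℕ :=
  hittingAfter (walk X) (Set.Ioi 0) 0

/-- `E τ⁺`, as an extended nonnegative number. -/
noncomputable def meanLadderTime (P : Measure Ω) (X : ℕ → Ω → ℝ) : ℝ≥0∞ :=
  ∫⁻ ω, ENat.toENNReal (ladderTime X ω) ∂P

/-- `φ(y) = E_y (γ(Y_{τ⁺}) - ∑_{i=1}^{τ⁺} h(Y_i))`. For constant `h`, monotone `γ` and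
`E τ⁺ < ∞`, the integrability assumption in `StandardAssumption` makes the integrand integrable:
it is at least `γ(y) - c τ⁺` and at most `sup_n (γ(Y_n) - c n)`. -/
noncomputable def phi (P : Measure Ω) (γ h : ℝ → ℝ) (X : ℕ → Ω → ℝ) (y : ℝ) : ℝ :=
  ∫ ω, stoppedValue (payoff γ h X y) (ladderTime X) ω ∂P

/-- `f(y) = (φ(y) - γ(y)) / E_y τ⁺`. -/
noncomputable def f (P : Measure Ω) (γ h : ℝ → ℝ) (X : ℕ → Ω → ℝ) (y : ℝ) : ℝ :=
  (phi P γ h X y - γ y) / (meanLadderTime P X).toReal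

end WalkStopping

/-! Cut the path at its strict records. From a record at height `z` to the next one the walk runs
through a fresh ladder excursion: on average this costs `c * m`, where `m` is the mean ladder time
(`meanIdx`), and earns `gain z`. Payoffs may have infinite negative part, so everything is phrased
through the loss `Z - payoff`, with `Z` the pathwise supremum of the payoffs. The loss is a.s.
non-negative and can be integrated in `[0, ∞]`.

Let `T` be the first record at or after `N`, and let `σ = min τ T`. Summing over the records in `[σ,
T)`, counted from `σ`, telescoping and the Markov property give `E loss(σ) + E ∑ c m = E loss(T) + E
∑ gain(Y_n)` (`lintegral_loss_balance`). Let `B` be the proposed half-line and `w = (c m - gain)⁺`.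
By the choice of `xbar` and concavity, `gain ≥ c m` off `B`, `gain ≤ c m` on `B`, and `gain`
decreases on `B`; hence `w` is non-decreasing. Therefore `E loss(T) ≤ E loss(σ) + E ∑ w(Y_n)`, with
equality for the entrance time into `B`, whose later records all stay in `B`.

It remains to see that `E ∑ w(Y_n)` is largest for the entrance time. Inserting the factor (block
length) / `m` does not change the expectation, and the sum of block lengths times `w` is the sum
over `σ ≤ j < T` of the running maximum of `w` from time `σ`; this only grows if counting starts at
`0`. Records counted from `0` with `w > 0` lie in `B`, and are records counted from the entrance
time. This is `lintegral_loss_truncTime_le`.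

As `N → ∞`, Fatou's lemma handles the entrance time. For a competitor `τ`, concavity bounds the
profit missed after `T` by an integrable variable independent of the past, so truncation costs at
most a constant times `P (N < τ)` (`lintegral_loss_truncTime_le_add`). -/

set_option linter.unusedSectionVars false

namespace WalkStopping

/-! ### Strict records of a deterministic sequence -/

section Paths

/-- `n` is a strict record of the sequence `Y` counted from time `s`. -/
def IsRec (Y : ℕ → ℝ) (s n : ℕ) : Prop := ∀ i, s ≤ i → i < n → Y i < Y n

/-- The first time after `n` at which `Y` exceeds its value at time `n`. -/
noncomputable def nextRec (Y : ℕ → ℝ) (n : ℕ) : ℕ := sInf {k | n < k ∧ Y n < Y k}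

lemma nextRec_spec {Y : ℕ → ℝ} {n : ℕ} (h : ∃ k, n < k ∧ Y n < Y k) :
    n < nextRec Y n ∧ Y n < Y (nextRec Y n) :=
  Nat.sInf_mem (s := {k | n < k ∧ Y n < Y k}) h

lemma le_of_lt_nextRec {Y : ℕ → ℝ} {n j : ℕ} (hnj : n ≤ j) (hj : j < nextRec Y n) :
    Y j ≤ Y n := by
  rcases hnj.eq_or_lt with rfl | hlt
  · exact le_rfl
  · by_contra! hc
    exact Nat.notMem_of_lt_sInf hj ⟨hlt, hc⟩

open Classical in
/-- The strict records of `Y` from time `s`, before time `T`. -/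
noncomputable def recs (Y : ℕ → ℝ) (s T : ℕ) : Finset ℕ :=
  (Finset.Ico s T).filter (IsRec Y s)

lemma mem_recs {Y : ℕ → ℝ} {s T n : ℕ} : n ∈ recs Y s T ↔ (s ≤ n ∧ n < T) ∧ IsRec Y s n := by
  simp [recs]

lemma IsRec.mono {Y : ℕ → ℝ} {s t n : ℕ} (h : IsRec Y s n) (hst : s ≤ t) : IsRec Y t n :=
  fun i hi hin => h i (hst.trans hi) hin

/-- The intervals between consecutive records partition `[s, T)`. -/
lemma sum_recs {M : Type*} [AddCommMonoid M] (G : ℕ → M) (Y : ℕ → ℝ) (T : ℕ) (s : ℕ)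
    (hs : s ≤ T) (hT : IsRec Y s T) :
    ∑ n ∈ recs Y s T, ∑ j ∈ Finset.Ico n (nextRec Y n), G j = ∑ j ∈ Finset.Ico s T, G j := by
  induction hk : T - s using Nat.strong_induction_on generalizing s with
  | _ k ih =>
    rcases hs.eq_or_lt with rfl | hlt
    · simp [recs]
    · have hex : ∃ k, s < k ∧ Y s < Y k := ⟨T, hlt, hT s le_rfl hlt⟩
      obtain ⟨h1, h2⟩ := nextRec_spec hex
      set r := nextRec Y s with hr
      have hrT : r ≤ T := Nat.sInf_le ⟨hlt, hT s le_rfl hlt⟩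
      -- `Y s` is not exceeded strictly between `s` and `r`, so no record lies there. A record from
      -- `r` is at least as high as `Y r > Y s`, so it is also a record from `s`.
      have hC : recs Y s T = insert s (recs Y r T) := by
        ext n
        simp only [mem_recs, Finset.mem_insert]
        constructor
        · rintro ⟨⟨h3, h4⟩, h5⟩
          rcases h3.eq_or_lt with rfl | h3
          · exact Or.inl rfl
          · have hrn : r ≤ n := Nat.sInf_le ⟨h3, h5 s le_rfl h3⟩
            exact Or.inr ⟨⟨hrn, h4⟩, h5.mono h1.le⟩
        · rintro (rfl | ⟨⟨h3, h4⟩, h5⟩)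
          · exact ⟨⟨le_rfl, hlt⟩, fun i hi hin => absurd hin (by omega)⟩
          · refine ⟨⟨h1.le.trans h3, h4⟩, fun i hi hin => ?_⟩
            rcases lt_or_ge i r with hir | hir
            · have := le_of_lt_nextRec hi hir
              rcases h3.eq_or_lt with rfl | h3
              · exact this.trans_lt h2
              · exact this.trans_lt (h2.trans (h5 r le_rfl h3))
            · exact h5 i hir hin
      have hns : s ∉ recs Y r T := by
        rw [mem_recs]; omega
      rw [hC, Finset.sum_insert hns, ih (T - r) (by omega) r hrT (hT.mono h1.le) rfl,
        ← Finset.sum_Ico_consecutive G h1.le hrT]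

lemma sum_recs_sub (F : ℕ → ℝ) (Y : ℕ → ℝ) {s T : ℕ} (hs : s ≤ T) (hT : IsRec Y s T) :
    ∑ n ∈ recs Y s T, (F (nextRec Y n) - F n) = F T - F s := by
  rw [← Finset.sum_Ico_sub F hs, ← sum_recs _ Y T s hs hT]
  refine Finset.sum_congr rfl fun n hn => ?_
  rw [mem_recs] at hn
  rw [Finset.sum_Ico_sub F (nextRec_spec ⟨T, hn.1.2, hT n hn.1.1 hn.1.2⟩).1.le]

/-- Between a record `n` and the next one the running maximum from `s` is `Y n`. The right-hand side
no longer mentions records, which makes its dependence on `s` transparent. -/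
lemma sum_recs_mul {w : ℝ → ℝ≥0∞} (hw : Monotone w) (Y : ℕ → ℝ) {s T : ℕ} (hs : s ≤ T)
    (hT : IsRec Y s T) :
    ∑ n ∈ recs Y s T, ((nextRec Y n - n : ℕ) : ℝ≥0∞) * w (Y n) =
      ∑ j ∈ Finset.Ico s T, ⨆ i ∈ Finset.Icc s j, w (Y i) := by
  rw [← sum_recs _ Y T s hs hT]
  refine Finset.sum_congr rfl fun n hn => ?_
  rw [mem_recs] at hn
  rw [← Nat.card_Ico, ← nsmul_eq_mul, ← Finset.sum_const]
  refine Finset.sum_congr rfl fun j hj => ?_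
  rw [Finset.mem_Ico] at hj
  apply le_antisymm
  · exact le_iSup₂_of_le n (Finset.mem_Icc.2 ⟨hn.1.1, hj.1⟩) le_rfl
  · refine iSup₂_le fun i hi => hw ?_
    rw [Finset.mem_Icc] at hi
    rcases lt_or_ge i n with h | h
    · exact (hn.2 i hi.1 h).le
    · exact le_of_lt_nextRec h (hi.2.trans_lt hj.2)

/-- The weighted occupation of records is largest when one counts from the start. -/
lemma sum_recs_mul_le {w : ℝ → ℝ≥0∞} (hw : Monotone w) (Y : ℕ → ℝ) {s T : ℕ} (hs : s ≤ T)
    (hT : IsRec Y 0 T) :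
    ∑ n ∈ recs Y s T, ((nextRec Y n - n : ℕ) : ℝ≥0∞) * w (Y n) ≤
      ∑ n ∈ recs Y 0 T, ((nextRec Y n - n : ℕ) : ℝ≥0∞) * w (Y n) := by
  rw [sum_recs_mul hw Y hs (hT.mono (Nat.zero_le _)), sum_recs_mul hw Y (Nat.zero_le _) hT]
  refine (Finset.sum_le_sum fun j _ => ?_).trans
    (Finset.sum_le_sum_of_subset (Finset.Ico_subset_Ico_left (Nat.zero_le s)))
  exact biSup_mono fun i hi => by
    rw [Finset.mem_Icc] at hi ⊢; omega

/-- The first strict record at or after time `N`. -/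
noncomputable def recAfter (Y : ℕ → ℝ) (N : ℕ) : ℕ := sInf {n | N ≤ n ∧ IsRec Y 0 n}

lemma recAfter_spec {Y : ℕ → ℝ} (h : ∀ n, ∃ k, n < k ∧ Y n < Y k) (N : ℕ) :
    N ≤ recAfter Y N ∧ IsRec Y 0 (recAfter Y N) := by
  refine Nat.sInf_mem (s := {n | N ≤ n ∧ IsRec Y 0 n}) ?_
  induction N with
  | zero => exact ⟨0, le_rfl, fun i _ hi => absurd hi (by omega)⟩
  | succ N ih =>
    obtain ⟨n, hn, hr⟩ := ih
    rcases hn.eq_or_lt with rfl | hlt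
    · obtain ⟨h1, h2⟩ := nextRec_spec (h N)
      refine ⟨nextRec Y N, h1, fun i _ hi => ?_⟩
      rcases lt_or_ge i N with h3 | h3
      · exact (hr i (Nat.zero_le _) h3).trans h2
      · exact (le_of_lt_nextRec h3 hi).trans_lt h2
    · exact ⟨n, hlt, hr⟩

/-- The right-hand side involves only the path up to time `n`, which gives adaptedness. -/
lemma lt_recAfter_iff {Y : ℕ → ℝ} (h : ∀ n, ∃ k, n < k ∧ Y n < Y k) {N n : ℕ} :
    n < recAfter Y N ↔ ∀ k, N ≤ k → k ≤ n → ¬ IsRec Y 0 k := by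
  constructor
  · intro hn k hk hkn hr
    exact Nat.notMem_of_lt_sInf (hkn.trans_lt hn) ⟨hk, hr⟩
  · intro hn
    by_contra! hc
    obtain ⟨h1, h2⟩ := recAfter_spec h N
    exact hn _ h1 hc h2

end Paths

/-! ### The Markov property of the walk -/

section Markov

variable {Ω : Type*} [MeasurableSpace Ω]

lemma measurable_nat_sInf {α : Type*} [MeasurableSpace α] {p : ℕ → α → Prop}
    (hp : ∀ n, MeasurableSet {x | p n x}) : Measurable fun x => sInf {n | p n x} := by
  classical
  refine measurable_to_countable' fun n => ?_
  -- The second set accounts for `sInf ∅ = 0`.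
  have : (fun x => sInf {n | p n x}) ⁻¹' {n} =
      {x | p n x ∧ ∀ k < n, ¬ p k x} ∪ {x | n = 0 ∧ ∀ k, ¬ p k x} := by
    ext x
    simp only [Set.mem_preimage, Set.mem_singleton_iff, Set.mem_union, Set.mem_ofPred_eq]
    by_cases hx : ∃ k, p k x
    · constructor
      · rintro rfl
        exact Or.inl ⟨Nat.sInf_mem (s := {n | p n x}) hx, fun k hk => Nat.notMem_of_lt_sInf hk⟩
      · rintro (⟨h1, h2⟩ | ⟨_, h2⟩)
        · apply le_antisymm (Nat.sInf_le h1)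
          by_contra! hc
          exact h2 _ hc (Nat.sInf_mem (s := {n | p n x}) hx)
        · exact absurd hx (by push Not; exact h2)
    · push Not at hx
      have : {n | p n x} = ∅ := by ext k; simp [hx k]
      simp only [this, Nat.sInf_empty]
      constructor
      · intro h; exact Or.inr ⟨h.symm, hx⟩
      · rintro (⟨h1, _⟩ | ⟨h1, _⟩)
        · exact absurd h1 (hx n)
        · exact h1.symm
  rw [this]
  have h1 : MeasurableSet {x | ∀ k < n, ¬ p k x} := by
    have : {x | ∀ k < n, ¬ p k x} = ⋂ k, ⋂ (_ : k < n), {x | p k x}ᶜ := by ext; simp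
    rw [this]
    exact .iInter fun k => .iInter fun _ => (hp k).compl
  have h2 : MeasurableSet {x | ∀ k, ¬ p k x} := by
    have : {x | ∀ k, ¬ p k x} = ⋂ k, {x | p k x}ᶜ := by ext; simp
    rw [this]
    exact .iInter fun k => (hp k).compl
  exact MeasurableSet.union (.inter (hp n) h1) (.inter (.const _) h2)

lemma map_shift_eq (P : Measure Ω) [IsProbabilityMeasure P] {X : ℕ → Ω → ℝ}
    (hX : ∀ i, Measurable (X i)) (hindep : iIndepFun X P)
    (hident : ∀ i, IdentDistrib (X i) (X 0) P P) (n : ℕ) :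
    P.map (fun ω i => X (n + i) ω) = P.map (fun ω i => X i ω) := by
  rw [iIndepFun.map_fun_eq_infinitePi_map hX hindep,
    iIndepFun.map_fun_eq_infinitePi_map (X := fun i => X (n + i)) (fun i => hX _)
      (hindep.precomp (add_right_injective n))]
  congr 1
  funext i
  rw [(hident (n + i)).map_eq, (hident i).map_eq]

lemma walkFiltration_le (X : ℕ → Ω → ℝ) (hX : ∀ i, Measurable (X i)) (n : ℕ) :
    walkFiltration X hX n ≤ ⨆ i ∈ Set.Iio n, MeasurableSpace.comap (X i) inferInstance := by
  refine iSup₂_le fun k hk => ?_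
  rw [← measurable_iff_comap_le]
  refine Finset.measurable_fun_sum _ fun i hi => ?_
  rw [measurable_iff_comap_le]
  exact le_iSup₂_of_le i (Set.mem_Iio.2 ((Finset.mem_range.1 hi).trans_le hk)) le_rfl

lemma measurable_walk_filtration (X : ℕ → Ω → ℝ) (hX : ∀ i, Measurable (X i)) {k n : ℕ}
    (hk : k ≤ n) : Measurable[walkFiltration X hX n] (walk X k) := by
  rw [measurable_iff_comap_le]
  exact le_iSup₂_of_le (f := fun k (_ : k ≤ n) => MeasurableSpace.comap (walk X k) _) k hk le_rfl

lemma measurable_chain_filtration (X : ℕ → Ω → ℝ) (hX : ∀ i, Measurable (X i)) (y : ℝ) {k n : ℕ}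
    (hk : k ≤ n) : Measurable[walkFiltration X hX n] (chain X y k) :=
  (measurable_walk_filtration X hX hk).const_add y

lemma measurable_chain {X : ℕ → Ω → ℝ} (hX : ∀ i, Measurable (X i)) (y : ℝ) (n : ℕ) :
    Measurable (chain X y n) :=
  (measurable_walk hX n).const_add y

/-- The Markov property of the walk at time `n`. -/
lemma lintegral_indicator_markov (P : Measure Ω) [IsProbabilityMeasure P] {X : ℕ → Ω → ℝ}
    (hX : ∀ i, Measurable (X i)) (hindep : iIndepFun X P)
    (hident : ∀ i, IdentDistrib (X i) (X 0) P P) (y : ℝ) (n : ℕ) {A : Set Ω}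
    (hA : MeasurableSet[walkFiltration X hX n] A) {K : ℝ → (ℕ → ℝ) → ℝ≥0∞}
    (hK : Measurable (Function.uncurry K)) :
    ∫⁻ ω, A.indicator (fun ω => K (chain X y n ω) (fun i => X (n + i) ω)) ω ∂P =
      ∫⁻ ω, A.indicator (fun ω => ∫⁻ ω', K (chain X y n ω) (fun i => X i ω') ∂P) ω ∂P := by
  classical
  -- The event enters as a random factor, so that one variable carries all that is needed of the
  -- past and is independent of the later increments.
  let U : Ω → ℝ≥0∞ × ℝ := fun ω => (A.indicator (fun _ => 1) ω, chain X y n ω)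
  let W : Ω → ℕ → ℝ := fun ω i => X (n + i) ω
  have hU' : Measurable[walkFiltration X hX n] U :=
    Measurable.prodMk (measurable_const.indicator hA) (measurable_chain_filtration X hX y le_rfl)
  have hU : Measurable U := hU'.mono ((walkFiltration X hX).le n) le_rfl
  have hW : Measurable W := measurable_pi_iff.2 fun i => hX _
  have hX' : Measurable (fun ω i => X i ω) := measurable_pi_iff.2 hX
  have hUW : IndepFun U W P := by
    have h := indep_iSup_of_disjoint (fun i => (hX i).comap_le) hindep
      (S := Set.Iio n) (T := Set.Ici n) (Set.disjoint_left.2 fun i h1 h2 => by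
        simp only [Set.mem_Iio, Set.mem_Ici] at h1 h2; omega)
    refine indep_of_indep_of_le_left (indep_of_indep_of_le_right h ?_) ?_
    · rw [← measurable_iff_comap_le]
      refine @measurable_pi_iff _ _ _ (_) _ _ |>.2 fun i => ?_
      rw [measurable_iff_comap_le]
      exact le_iSup₂_of_le (n + i) (Set.mem_Ici.2 (Nat.le_add_right _ _)) le_rfl
    · exact (measurable_iff_comap_le.1 hU').trans (walkFiltration_le X hX n)
  have hKm : Measurable fun q : (ℝ≥0∞ × ℝ) × (ℕ → ℝ) => q.1.1 * K q.1.2 q.2 :=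
    (measurable_fst.comp measurable_fst).mul
      (hK.comp ((measurable_snd.comp measurable_fst).prodMk measurable_snd))
  calc ∫⁻ ω, A.indicator (fun ω => K (chain X y n ω) (fun i => X (n + i) ω)) ω ∂P
      = ∫⁻ ω, (U ω).1 * K (U ω).2 (W ω) ∂P := by
        refine lintegral_congr fun ω => ?_
        by_cases h : ω ∈ A <;> simp [U, W, h]
    _ = ∫⁻ q, q.1.1 * K q.1.2 q.2 ∂(P.map fun ω => (U ω, W ω)) :=
        (lintegral_map hKm (hU.prodMk hW)).symm
    _ = ∫⁻ u, ∫⁻ v, u.1 * K u.2 v ∂(P.map W) ∂(P.map U) := by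
        rw [hUW.map_prod_eq_prod_map_map hU.aemeasurable hW.aemeasurable,
          lintegral_prod _ hKm.aemeasurable]
    _ = ∫⁻ u, ∫⁻ ω', u.1 * K u.2 (fun i => X i ω') ∂P ∂(P.map U) := by
        refine lintegral_congr fun u => ?_
        rw [map_shift_eq P hX hindep hident n, lintegral_map _ hX']
        exact hKm.comp (measurable_const.prodMk measurable_id)
    _ = ∫⁻ ω, ∫⁻ ω', (U ω).1 * K (U ω).2 (fun i => X i ω') ∂P ∂P := by
        refine lintegral_map (f := fun u : ℝ≥0∞ × ℝ => ∫⁻ ω', u.1 * K u.2 (fun i => X i ω') ∂P)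
          ?_ hU
        exact Measurable.lintegral_prod_right'
          (hKm.comp (measurable_fst.prodMk (hX'.comp measurable_snd)))
    _ = _ := by
        refine lintegral_congr fun ω => ?_
        by_cases h : ω ∈ A <;> simp [U, h]

end Markov

/-! ### Ladder blocks of the walk and records counted from a random time -/

variable {Ω : Type*} [MeasurableSpace Ω]

/-- Partial sums of a sequence of reals. -/
def psum (x : ℕ → ℝ) (k : ℕ) : ℝ := ∑ i ∈ Finset.range k, x i

/-- The first index at which the partial sums are positive (`0` if there is none). -/
noncomputable def ladderIdx (x : ℕ → ℝ) : ℕ := sInf {k | 0 < psum x k}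

lemma measurable_psum (k : ℕ) : Measurable fun x : ℕ → ℝ => psum x k :=
  Finset.measurable_fun_sum _ fun i _ => measurable_pi_apply i

lemma measurable_ladderIdx : Measurable ladderIdx :=
  measurable_nat_sInf fun k => measurableSet_lt measurable_const (measurable_psum k)

lemma measurable_psum_ladderIdx : Measurable fun x : ℕ → ℝ => psum x (ladderIdx x) := by
  have h : Measurable fun q : ℕ × (ℕ → ℝ) => psum q.2 q.1 :=
    measurable_from_prod_countable_right fun k => measurable_psum k
  exact h.comp (measurable_ladderIdx.prodMk measurable_id)

lemma chain_add (X : ℕ → Ω → ℝ) (y : ℝ) (n k : ℕ) (ω : Ω) :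
    chain X y (n + k) ω = chain X y n ω + psum (fun i => X (n + i) ω) k := by
  simp only [chain, walk, psum, Finset.sum_range_add]; ring

lemma nextRec_chain {X : ℕ → Ω → ℝ} {y : ℝ} {n : ℕ} {ω : Ω}
    (h : ∃ k, n < k ∧ chain X y n ω < chain X y k ω) :
    nextRec (fun k => chain X y k ω) n = n + ladderIdx (fun i => X (n + i) ω) := by
  obtain ⟨h1, h2⟩ := nextRec_spec (Y := fun k => chain X y k ω) h
  set r := nextRec (fun k => chain X y k ω) n with hr
  obtain ⟨k, hk⟩ := Nat.exists_eq_add_of_lt h1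
  have hk' : r = n + (k + 1) := by omega
  rw [hk', chain_add] at h2
  have hmem : 0 < psum (fun i => X (n + i) ω) (k + 1) := by linarith
  have hle : ladderIdx (fun i => X (n + i) ω) ≤ k + 1 := Nat.sInf_le hmem
  have hpos : 0 < psum (fun i => X (n + i) ω) (ladderIdx fun i => X (n + i) ω) :=
    Nat.sInf_mem (s := {k | 0 < psum (fun i => X (n + i) ω) k}) ⟨_, hmem⟩
  have h0 : 0 < ladderIdx (fun i => X (n + i) ω) := by
    rcases Nat.eq_zero_or_pos (ladderIdx fun i => X (n + i) ω) with h0 | h0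
    · rw [h0] at hpos; simp [psum] at hpos
    · exact h0
  apply le_antisymm
  · refine Nat.sInf_le ⟨by omega, ?_⟩
    show chain X y n ω < chain X y _ ω
    rw [chain_add]; linarith
  · omega

/-- An i.i.d. walk that almost surely climbs above each of its values later on. -/
structure ClimbingWalk (P : Measure Ω) (X : ℕ → Ω → ℝ) : Prop where
  meas : ∀ i, Measurable (X i)
  indep : iIndepFun X P
  ident : ∀ i, IdentDistrib (X i) (X 0) P P
  climb : ∀ᵐ ω ∂P, ∀ n, ∃ k, n < k ∧ walk X n ω < walk X k ω

lemma ClimbingWalk.chain_climb {P : Measure Ω} {X : ℕ → Ω → ℝ} (H : ClimbingWalk P X) (y : ℝ) :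
    ∀ᵐ ω ∂P, ∀ n, ∃ k, n < k ∧ chain X y n ω < chain X y k ω := by
  filter_upwards [H.climb] with ω hω n
  obtain ⟨k, h1, h2⟩ := hω n
  exact ⟨k, h1, by simpa [chain] using h2⟩

/-- The first strict record of the chain at or after time `N`. -/
noncomputable def recTime (X : ℕ → Ω → ℝ) (y : ℝ) (N : ℕ) (ω : Ω) : ℕ :=
  recAfter (fun k => chain X y k ω) N

/-- The random time `τ`, truncated at `recTime X y N`. -/
noncomputable def truncTime (X : ℕ → Ω → ℝ) (y : ℝ) (N : ℕ) (τ : Ω → WithTop ℕ) (ω : Ω) : ℕ :=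
  (min (τ ω) (recTime X y N ω : WithTop ℕ)).untopD 0

lemma coe_truncTime (X : ℕ → Ω → ℝ) (y : ℝ) (N : ℕ) (τ : Ω → WithTop ℕ) (ω : Ω) :
    (truncTime X y N τ ω : WithTop ℕ) = min (τ ω) (recTime X y N ω : WithTop ℕ) := by
  unfold truncTime
  generalize hz : min (τ ω) (recTime X y N ω : WithTop ℕ) = z
  cases z with
  | top => simp at hz
  | coe a => rfl

lemma truncTime_le (X : ℕ → Ω → ℝ) (y : ℝ) (N : ℕ) (τ : Ω → WithTop ℕ) (ω : Ω) :
    truncTime X y N τ ω ≤ recTime X y N ω := by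
  have := coe_truncTime X y N τ ω
  have h : (truncTime X y N τ ω : WithTop ℕ) ≤ (recTime X y N ω : WithTop ℕ) :=
    this ▸ min_le_right _ _
  exact_mod_cast h

/-- Before `recTime` the truncation is invisible, so `recEvent` can be written with `τ` itself and
is measurable at time `n`. -/
lemma truncTime_le_iff (X : ℕ → Ω → ℝ) (y : ℝ) (N : ℕ) (τ : Ω → WithTop ℕ) (ω : Ω) {n : ℕ}
    (hn : n < recTime X y N ω) : truncTime X y N τ ω ≤ n ↔ τ ω ≤ n := by
  have := coe_truncTime X y N τ ω
  have h : truncTime X y N τ ω ≤ n ↔ (truncTime X y N τ ω : WithTop ℕ) ≤ (n : WithTop ℕ) :=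
    WithTop.coe_le_coe.symm
  rw [h, this, min_le_iff]
  constructor
  · rintro (h | h)
    · exact h
    · have h' : recTime X y N ω ≤ n := by exact_mod_cast h
      omega
  · exact Or.inl

/-- The records of the chain from time `τ` on and before `recTime X y N`. -/
noncomputable def recsFrom (X : ℕ → Ω → ℝ) (y : ℝ) (N : ℕ) (τ : Ω → WithTop ℕ) (ω : Ω) :
    Finset ℕ :=
  recs (fun k => chain X y k ω) (truncTime X y N τ ω) (recTime X y N ω)

/-- The event that `n` is one of the records of `recsFrom`. -/
def recEvent (X : ℕ → Ω → ℝ) (y : ℝ) (N : ℕ) (τ : Ω → WithTop ℕ) (n : ℕ) : Set Ω :=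
  {ω | τ ω ≤ n ∧ (∀ k, N ≤ k → k ≤ n → ¬ IsRec (fun k => chain X y k ω) 0 k) ∧
    ∀ i < n, τ ω ≤ i → chain X y i ω < chain X y n ω}

lemma mem_recsFrom_iff {X : ℕ → Ω → ℝ} {y : ℝ} {ω : Ω}
    (hω : ∀ n, ∃ k, n < k ∧ chain X y n ω < chain X y k ω) (N : ℕ) (τ : Ω → WithTop ℕ) (n : ℕ) :
    n ∈ recsFrom X y N τ ω ↔ ω ∈ recEvent X y N τ n := by
  have h1 : n < recTime X y N ω ↔ ∀ k, N ≤ k → k ≤ n → ¬ IsRec (fun k => chain X y k ω) 0 k :=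
    lt_recAfter_iff (Y := fun k => chain X y k ω) hω
  rw [recsFrom, mem_recs, recEvent, Set.mem_ofPred_eq, ← h1]
  constructor
  · rintro ⟨⟨h2, h3⟩, h4⟩
    refine ⟨(truncTime_le_iff X y N τ ω h3).1 h2, h3, fun i hi h5 => h4 i ?_ hi⟩
    exact (truncTime_le_iff X y N τ ω (hi.trans h3)).2 h5
  · rintro ⟨h2, h3, h4⟩
    refine ⟨⟨(truncTime_le_iff X y N τ ω h3).2 h2, h3⟩, fun i hi h5 => h4 i h5 ?_⟩
    exact (truncTime_le_iff X y N τ ω (h5.trans h3)).1 hi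

lemma measurableSet_isRec (X : ℕ → Ω → ℝ) (hX : ∀ i, Measurable (X i)) (y : ℝ) {k n : ℕ}
    (hk : k ≤ n) :
    MeasurableSet[walkFiltration X hX n] {ω | IsRec (fun k => chain X y k ω) 0 k} := by
  have : {ω | IsRec (fun k => chain X y k ω) 0 k} =
      ⋂ i, ⋂ (_ : i < k), {ω | chain X y i ω < chain X y k ω} := by
    ext; simp [IsRec]
  rw [this]
  exact MeasurableSet.iInter fun i => MeasurableSet.iInter fun hi =>
    measurableSet_lt (measurable_chain_filtration X hX y (hi.le.trans hk))
      (measurable_chain_filtration X hX y hk)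

lemma measurableSet_noRec (X : ℕ → Ω → ℝ) (hX : ∀ i, Measurable (X i)) (y : ℝ) (N n : ℕ) :
    MeasurableSet[walkFiltration X hX n]
      {ω | ∀ k, N ≤ k → k ≤ n → ¬ IsRec (fun k => chain X y k ω) 0 k} := by
  have : {ω | ∀ k, N ≤ k → k ≤ n → ¬ IsRec (fun k => chain X y k ω) 0 k} =
      ⋂ k, ⋂ (_ : N ≤ k), ⋂ (_ : k ≤ n), {ω | IsRec (fun k => chain X y k ω) 0 k}ᶜ := by
    ext; simp
  rw [this]
  exact MeasurableSet.iInter fun k => MeasurableSet.iInter fun _ => MeasurableSet.iInter fun hk =>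
    (measurableSet_isRec X hX y hk).compl

lemma measurableSet_recEvent (X : ℕ → Ω → ℝ) (hX : ∀ i, Measurable (X i)) (y : ℝ) (N : ℕ)
    {τ : Ω → WithTop ℕ} (hτ : IsStoppingTime (walkFiltration X hX) τ) (n : ℕ) :
    MeasurableSet[walkFiltration X hX n] (recEvent X y N τ n) := by
  have h3 : MeasurableSet[walkFiltration X hX n]
      {ω | ∀ i < n, τ ω ≤ i → chain X y i ω < chain X y n ω} := by
    have : {ω | ∀ i < n, τ ω ≤ i → chain X y i ω < chain X y n ω} =
        ⋂ i, ⋂ (_ : i < n), {ω | τ ω ≤ i}ᶜ ∪ {ω | chain X y i ω < chain X y n ω} := by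
      ext; simp [imp_iff_not_or]
    rw [this]
    exact MeasurableSet.iInter fun i => MeasurableSet.iInter fun hi =>
      (((walkFiltration X hX).mono hi.le _ (hτ i)).compl).union
      (measurableSet_lt (measurable_chain_filtration X hX y hi.le)
        (measurable_chain_filtration X hX y le_rfl))
  exact (hτ n).inter ((measurableSet_noRec X hX y N n).inter h3)

lemma sum_recsFrom_eq_tsum {X : ℕ → Ω → ℝ} {y : ℝ} {ω : Ω}
    (hω : ∀ n, ∃ k, n < k ∧ chain X y n ω < chain X y k ω) (N : ℕ) (τ : Ω → WithTop ℕ)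
    (G : ℕ → Ω → ℝ≥0∞) :
    ∑ n ∈ recsFrom X y N τ ω, G n ω = ∑' n, (recEvent X y N τ n).indicator (G n) ω := by
  rw [tsum_eq_sum (s := recsFrom X y N τ ω)]
  · refine Finset.sum_congr rfl fun n hn => ?_
    rw [Set.indicator_of_mem ((mem_recsFrom_iff hω N τ n).1 hn)]
  · intro n hn
    rw [Set.indicator_of_notMem fun h => hn ((mem_recsFrom_iff hω N τ n).2 h)]

lemma recTime_isRec {X : ℕ → Ω → ℝ} {y : ℝ} {ω : Ω}
    (hω : ∀ n, ∃ k, n < k ∧ chain X y n ω < chain X y k ω) (N : ℕ) :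
    N ≤ recTime X y N ω ∧ IsRec (fun k => chain X y k ω) 0 (recTime X y N ω) :=
  recAfter_spec (Y := fun k => chain X y k ω) hω N

/-! ### Wald-type identities for sums over records -/

section Expectations

variable {P : Measure Ω} [IsProbabilityMeasure P] {X : ℕ → Ω → ℝ}

lemma aemeasurable_sum_recsFrom (H : ClimbingWalk P X) (y : ℝ) (N : ℕ) {τ : Ω → WithTop ℕ}
    (hτ : IsStoppingTime (walkFiltration X H.meas) τ) {G : ℕ → Ω → ℝ≥0∞}
    (hG : ∀ n, Measurable (G n)) :
    AEMeasurable (fun ω => ∑ n ∈ recsFrom X y N τ ω, G n ω) P := by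
  refine ⟨fun ω => ∑' n, (recEvent X y N τ n).indicator (G n) ω, ?_, ?_⟩
  · exact Measurable.tsum fun n => (hG n).indicator
      ((walkFiltration X H.meas).le n _ (measurableSet_recEvent X H.meas y N hτ n))
  · filter_upwards [H.chain_climb y] with ω hω
    exact sum_recsFrom_eq_tsum hω N τ G

/-- Being a record at `n` is decided by time `n`, so the Markov property applies to each term of the
indicator series. -/
lemma lintegral_sum_recsFrom (H : ClimbingWalk P X) (y : ℝ) (N : ℕ) {τ : Ω → WithTop ℕ}
    (hτ : IsStoppingTime (walkFiltration X H.meas) τ) {K : ℝ → (ℕ → ℝ) → ℝ≥0∞}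
    (hK : Measurable (Function.uncurry K)) :
    ∫⁻ ω, ∑ n ∈ recsFrom X y N τ ω, K (chain X y n ω) (fun i => X (n + i) ω) ∂P =
      ∫⁻ ω, ∑ n ∈ recsFrom X y N τ ω, ∫⁻ ω', K (chain X y n ω) (fun i => X i ω') ∂P ∂P := by
  have hm : ∀ n, MeasurableSet (recEvent X y N τ n) := fun n =>
    (walkFiltration X H.meas).le n _ (measurableSet_recEvent X H.meas y N hτ n)
  have hX' : Measurable (fun ω i => X i ω) := measurable_pi_iff.2 H.meas
  have hsum : ∀ G : ℕ → Ω → ℝ≥0∞, (∀ n, Measurable (G n)) →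
      ∫⁻ ω, ∑ n ∈ recsFrom X y N τ ω, G n ω ∂P =
        ∑' n, ∫⁻ ω, (recEvent X y N τ n).indicator (G n) ω ∂P := by
    intro G hG
    rw [← lintegral_tsum fun n => ((hG n).indicator (hm n)).aemeasurable]
    refine lintegral_congr_ae ?_
    filter_upwards [H.chain_climb y] with ω hω
    exact sum_recsFrom_eq_tsum hω N τ G
  rw [hsum (fun n ω => K (chain X y n ω) (fun i => X (n + i) ω)) fun n =>
      hK.comp ((measurable_chain H.meas y n).prodMk (measurable_pi_iff.2 fun i => H.meas _)),
    hsum (fun n ω => ∫⁻ ω', K (chain X y n ω) (fun i => X i ω') ∂P) fun n =>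
      Measurable.lintegral_prod_right' (f := fun q : Ω × Ω => K (chain X y n q.1) fun i => X i q.2)
        (hK.comp (((measurable_chain H.meas y n).comp measurable_fst).prodMk
          (hX'.comp measurable_snd)))]
  exact tsum_congr fun n => lintegral_indicator_markov P H.meas H.indep H.ident y n
    (measurableSet_recEvent X H.meas y N hτ n) hK

/-- The mean of the first ladder index. -/
noncomputable def meanIdx (P : Measure Ω) (X : ℕ → Ω → ℝ) : ℝ≥0∞ :=
  ∫⁻ ω, (ladderIdx fun i => X i ω : ℝ≥0∞) ∂P

/-- The expected increase of `γ` up to the first ladder time, for the start `z`. -/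
noncomputable def gain (P : Measure Ω) (X : ℕ → Ω → ℝ) (γ : ℝ → ℝ) (z : ℝ) : ℝ≥0∞ :=
  ∫⁻ ω, ENNReal.ofReal (γ (z + psum (fun i => X i ω) (ladderIdx fun i => X i ω)) - γ z) ∂P

lemma measurable_gain_integrand {γ : ℝ → ℝ} (hγ : Monotone γ) :
    Measurable (Function.uncurry fun (z : ℝ) (x : ℕ → ℝ) =>
      ENNReal.ofReal (γ (z + psum x (ladderIdx x)) - γ z)) := by
  refine ENNReal.measurable_ofReal.comp (Measurable.sub (hγ.measurable.comp ?_)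
    (hγ.measurable.comp measurable_fst))
  exact measurable_fst.add (measurable_psum_ladderIdx.comp measurable_snd)

lemma measurable_gain {γ : ℝ → ℝ} (hγ : Monotone γ) (hX : ∀ i, Measurable (X i)) :
    Measurable (gain P X γ) :=
  Measurable.lintegral_prod_right' (f := fun q : ℝ × Ω =>
    ENNReal.ofReal (γ (q.1 + psum (fun i => X i q.2) (ladderIdx fun i => X i q.2)) - γ q.1))
    ((measurable_gain_integrand hγ).comp (measurable_fst.prodMk
      ((measurable_pi_iff.2 hX).comp measurable_snd)))

lemma nextRec_sub {y : ℝ} {ω : Ω} (hω : ∀ n, ∃ k, n < k ∧ chain X y n ω < chain X y k ω) (n : ℕ) :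
    nextRec (fun k => chain X y k ω) n - n = ladderIdx fun i => X (n + i) ω := by
  rw [nextRec_chain (hω n), Nat.add_sub_cancel_left]

/-- The block length depends on the fresh increments and the weight on the present height. Block
lengths can thus be exchanged for their mean, in either direction. -/
lemma lintegral_sum_nextRec_mul (H : ClimbingWalk P X) (y : ℝ) (N : ℕ) {τ : Ω → WithTop ℕ}
    (hτ : IsStoppingTime (walkFiltration X H.meas) τ) {w : ℝ → ℝ≥0∞} (hw : Measurable w) :
    ∫⁻ ω, ∑ n ∈ recsFrom X y N τ ω,
        ((nextRec (fun k => chain X y k ω) n - n : ℕ) : ℝ≥0∞) * w (chain X y n ω) ∂P =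
      ∫⁻ ω, ∑ n ∈ recsFrom X y N τ ω, meanIdx P X * w (chain X y n ω) ∂P := by
  have hl : Measurable fun x : ℕ → ℝ => (ladderIdx x : ℝ≥0∞) :=
    measurable_from_nat.comp measurable_ladderIdx
  have hX' : Measurable (fun ω i => X i ω) := measurable_pi_iff.2 H.meas
  have h := lintegral_sum_recsFrom H y N hτ (K := fun z x => (ladderIdx x : ℝ≥0∞) * w z)
    ((hl.comp measurable_snd).mul (hw.comp measurable_fst))
  have hk : ∀ z, ∫⁻ ω', (ladderIdx fun i => X i ω' : ℝ≥0∞) * w z ∂P = meanIdx P X * w z :=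
    fun z => lintegral_mul_const _ (hl.comp hX')
  simp only [hk] at h
  refine (lintegral_congr_ae ?_).trans h
  filter_upwards [H.chain_climb y] with ω hω
  exact Finset.sum_congr rfl fun n _ => by rw [nextRec_sub hω]

lemma lintegral_recTime_sub (H : ClimbingWalk P X) (y : ℝ) (N : ℕ) {τ : Ω → WithTop ℕ}
    (hτ : IsStoppingTime (walkFiltration X H.meas) τ) :
    ∫⁻ ω, ((recTime X y N ω - truncTime X y N τ ω : ℕ) : ℝ≥0∞) ∂P =
      ∫⁻ ω, ∑ _n ∈ recsFrom X y N τ ω, meanIdx P X ∂P := by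
  have h := lintegral_sum_nextRec_mul H y N hτ (w := fun _ => 1) measurable_const
  simp only [mul_one] at h
  rw [← h]
  refine lintegral_congr_ae ?_
  filter_upwards [H.chain_climb y] with ω hω
  have h1 := sum_recs_mul (w := fun _ => 1) monotone_const (fun k => chain X y k ω)
    (truncTime_le X y N τ ω) ((recTime_isRec hω N).2.mono (Nat.zero_le _))
  have h2 : ∀ j ∈ Finset.Ico (truncTime X y N τ ω) (recTime X y N ω),
      (⨆ i ∈ Finset.Icc (truncTime X y N τ ω) j, (1 : ℝ≥0∞)) = 1 := fun j hj =>
    le_antisymm (iSup₂_le fun _ _ => le_rfl)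
      (le_iSup₂_of_le j (Finset.mem_Icc.2 ⟨(Finset.mem_Ico.1 hj).1, le_rfl⟩) le_rfl)
  rw [Finset.sum_congr rfl h2] at h1
  simp only [mul_one, Finset.sum_const, Nat.card_Ico, nsmul_eq_mul] at h1
  exact h1.symm

/-- The increment of `γ` telescopes over the blocks, and each block contributes a non-negative term.
-/
lemma lintegral_gain (H : ClimbingWalk P X) (y : ℝ) (N : ℕ) {τ : Ω → WithTop ℕ}
    (hτ : IsStoppingTime (walkFiltration X H.meas) τ) {γ : ℝ → ℝ} (hγ : Monotone γ) :
    ∫⁻ ω, ENNReal.ofReal (γ (chain X y (recTime X y N ω) ω) -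
        γ (chain X y (truncTime X y N τ ω) ω)) ∂P =
      ∫⁻ ω, ∑ n ∈ recsFrom X y N τ ω, gain P X γ (chain X y n ω) ∂P := by
  refine Eq.trans (lintegral_congr_ae ?_)
    (lintegral_sum_recsFrom H y N hτ (measurable_gain_integrand hγ))
  filter_upwards [H.chain_climb y] with ω hω
  rw [← sum_recs_sub (fun n => γ (chain X y n ω)) (fun k => chain X y k ω)
    (truncTime_le X y N τ ω) ((recTime_isRec hω N).2.mono (Nat.zero_le _)),
    ENNReal.ofReal_sum_of_nonneg]
  · refine Finset.sum_congr rfl fun n _ => ?_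
    rw [nextRec_chain (hω n), chain_add]
  · intro n _
    exact sub_nonneg.2 (hγ (nextRec_spec (Y := fun k => chain X y k ω) (hω n)).2.le)

/-- `recTime` is the first record from `N` on, so every earlier record counted from `0` is less than
`N`. The resulting finite mean of `recTime` later justifies cancellation in `[0, ∞]`. -/
lemma card_recsFrom_le {y : ℝ} {ω : Ω} (hω : ∀ n, ∃ k, n < k ∧ chain X y n ω < chain X y k ω)
    (N : ℕ) (τ : Ω → WithTop ℕ) (hτ : τ ω = 0) : (recsFrom X y N τ ω).card ≤ N := by
  have : recsFrom X y N τ ω ⊆ Finset.range N := by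
    intro n hn
    obtain ⟨_, h2, h3⟩ := (mem_recsFrom_iff hω N τ n).1 hn
    rw [Finset.mem_range]
    by_contra! hc
    exact h2 n hc le_rfl fun i _ hin => h3 i hin (by simp [hτ])
  simpa using Finset.card_le_card this

lemma lintegral_recTime_le (H : ClimbingWalk P X) (y : ℝ) (N : ℕ) :
    ∫⁻ ω, (recTime X y N ω : ℝ≥0∞) ∂P ≤ N * meanIdx P X := by
  have h := lintegral_recTime_sub H y N (τ := fun _ => ((0 : ℕ) : WithTop ℕ))
    (isStoppingTime_const _ 0)
  have h0 : ∀ ω, truncTime X y N (fun _ => ((0 : ℕ) : WithTop ℕ)) ω = 0 := fun ω => by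
    have := coe_truncTime X y N (fun _ => ((0 : ℕ) : WithTop ℕ)) ω
    simpa using this
  simp only [h0, Nat.sub_zero] at h
  rw [h]
  calc ∫⁻ ω, ∑ _n ∈ recsFrom X y N (fun _ => ((0 : ℕ) : WithTop ℕ)) ω, meanIdx P X ∂P
      ≤ ∫⁻ _, N * meanIdx P X ∂P := by
        refine lintegral_mono_ae ?_
        filter_upwards [H.chain_climb y] with ω hω
        rw [Finset.sum_const, nsmul_eq_mul]
        gcongr
        exact card_recsFrom_le hω N _ rfl
    _ = N * meanIdx P X := by simp

end Expectations

/-! ### Comparison of truncated stopping times -/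

section Comparison

variable {P : Measure Ω} [IsProbabilityMeasure P] {X : ℕ → Ω → ℝ}

lemma payoff_const (γ : ℝ → ℝ) (c : ℝ) (X : ℕ → Ω → ℝ) (y : ℝ) (n : ℕ) (ω : Ω) :
    payoff γ (fun _ => c) X y n ω = γ (chain X y n ω) - c * n := by
  simp [payoff, mul_comm]

lemma measurable_payoff {γ : ℝ → ℝ} (hγ : Monotone γ) (c : ℝ) (hX : ∀ i, Measurable (X i)) (y : ℝ)
    (n : ℕ) : Measurable (payoff γ (fun _ => c) X y n) := by
  have : payoff γ (fun _ => c) X y n = fun ω => γ (chain X y n ω) - c * n := by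
    funext ω; exact payoff_const γ c X y n ω
  rw [this]
  exact (hγ.measurable.comp (measurable_chain hX y n)).sub measurable_const

lemma measurable_recTime (hX : ∀ i, Measurable (X i)) (y : ℝ) (N : ℕ) :
    Measurable (recTime X y N) :=
  measurable_nat_sInf fun n => (MeasurableSet.const (N ≤ n)).inter
    ((walkFiltration X hX).le n _ (measurableSet_isRec X hX y le_rfl))

lemma measurable_truncTime (hX : ∀ i, Measurable (X i)) (y : ℝ) (N : ℕ) {τ : Ω → WithTop ℕ}
    (hτ : IsStoppingTime (walkFiltration X hX) τ) : Measurable (truncTime X y N τ) := by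
  refine measurable_of_Iic fun n => ?_
  have : truncTime X y N τ ⁻¹' Set.Iic n = {ω | τ ω ≤ n} ∪ recTime X y N ⁻¹' Set.Iic n := by
    ext ω
    have h : truncTime X y N τ ω ≤ n ↔ (truncTime X y N τ ω : WithTop ℕ) ≤ (n : WithTop ℕ) :=
      WithTop.coe_le_coe.symm
    have h' : (recTime X y N ω : WithTop ℕ) ≤ (n : WithTop ℕ) ↔ recTime X y N ω ≤ n :=
      WithTop.coe_le_coe
    simp only [Set.mem_preimage, Set.mem_Iic, Set.mem_union, Set.mem_ofPred_eq]
    rw [h, coe_truncTime, min_le_iff, h']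
  rw [this]
  exact ((walkFiltration X hX).le n _ (hτ n)).union (measurable_recTime hX y N measurableSet_Iic)

/-- The loss of stopping at time `n` compared with the benchmark `Z`. -/
noncomputable def loss (Z : Ω → ℝ) (γ : ℝ → ℝ) (c : ℝ) (X : ℕ → Ω → ℝ) (y : ℝ) (n : ℕ) (ω : Ω) :
    ℝ≥0∞ :=
  ENNReal.ofReal (Z ω - payoff γ (fun _ => c) X y n ω)

lemma measurable_loss_comp {Z : Ω → ℝ} (hZ : Measurable Z) {γ : ℝ → ℝ} (hγ : Monotone γ) (c : ℝ)
    (hX : ∀ i, Measurable (X i)) (y : ℝ) {σ : Ω → ℕ} (hσ : Measurable σ) :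
    Measurable fun ω => loss Z γ c X y (σ ω) ω := by
  have h : Measurable fun q : ℕ × Ω => loss Z γ c X y q.1 q.2 :=
    measurable_from_prod_countable_right fun n =>
      ENNReal.measurable_ofReal.comp (hZ.sub (measurable_payoff hγ c hX y n))
  exact h.comp (hσ.prodMk measurable_id)

/-- Pathwise, `loss(s) + c (T - s) = loss(T) + (γ(Y_T) - γ(Y_s))`. Almost surely all terms are
non-negative, so integrating requires no integrability. -/
lemma lintegral_loss_balance (H : ClimbingWalk P X) {γ : ℝ → ℝ} (hγ : Monotone γ) {c : ℝ}
    (hc : 0 ≤ c) (y : ℝ) (N : ℕ) {τ : Ω → WithTop ℕ}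
    (hτ : IsStoppingTime (walkFiltration X H.meas) τ) {Z : Ω → ℝ} (hZ : Measurable Z)
    (hZp : ∀ᵐ ω ∂P, ∀ n, payoff γ (fun _ => c) X y n ω ≤ Z ω) :
    ∫⁻ ω, loss Z γ c X y (truncTime X y N τ ω) ω ∂P +
        ∫⁻ ω, ∑ _n ∈ recsFrom X y N τ ω, ENNReal.ofReal c * meanIdx P X ∂P =
      ∫⁻ ω, loss Z γ c X y (recTime X y N ω) ω ∂P +
        ∫⁻ ω, ∑ n ∈ recsFrom X y N τ ω, gain P X γ (chain X y n ω) ∂P := by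
  have h1 : ∫⁻ ω, ∑ _n ∈ recsFrom X y N τ ω, ENNReal.ofReal c * meanIdx P X ∂P =
      ∫⁻ ω, ENNReal.ofReal c * ((recTime X y N ω - truncTime X y N τ ω : ℕ) : ℝ≥0∞) ∂P := by
    simp_rw [← Finset.mul_sum]
    rw [lintegral_const_mul' _ _ ENNReal.ofReal_ne_top,
      lintegral_const_mul' _ _ ENNReal.ofReal_ne_top, lintegral_recTime_sub H y N hτ]
  rw [h1, ← lintegral_gain H y N hτ hγ,
    ← lintegral_add_left (measurable_loss_comp hZ hγ c H.meas y
      (measurable_truncTime H.meas y N hτ)),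
    ← lintegral_add_left (measurable_loss_comp hZ hγ c H.meas y (measurable_recTime H.meas y N))]
  refine lintegral_congr_ae ?_
  filter_upwards [H.chain_climb y, hZp] with ω hω hZω
  have hle := truncTime_le X y N τ ω
  have hrec := (recTime_isRec hω N).2
  set T := recTime X y N ω
  set s := truncTime X y N τ ω
  have hγs : γ (chain X y s ω) ≤ γ (chain X y T ω) := by
    rcases hle.eq_or_lt with h | h
    · rw [h]
    · exact hγ (hrec s (Nat.zero_le _) h).le
  have hs := hZω s
  have hT := hZω T
  have hcast : ((T - s : ℕ) : ℝ) = T - s := Nat.cast_sub hle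
  have hnn : (0 : ℝ) ≤ T - s := by rw [← hcast]; positivity
  rw [← ENNReal.ofReal_natCast (T - s), ← ENNReal.ofReal_mul hc, loss, loss,
    ← ENNReal.ofReal_add (by linarith) (by rw [hcast]; positivity),
    ← ENNReal.ofReal_add (by linarith) (by linarith), hcast, payoff_const, payoff_const]
  congr 1
  ring

lemma chain_mem_of_mem_recsFrom {B : Set ℝ} (hB : IsUpperSet B) {y : ℝ} {ω : Ω}
    (hω : ∀ n, ∃ k, n < k ∧ chain X y n ω < chain X y k ω) {N n : ℕ}
    (hn : n ∈ recsFrom X y N (hittingAfter (chain X y) B 0) ω) : chain X y n ω ∈ B := by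
  obtain ⟨h1, _, h3⟩ := (mem_recsFrom_iff hω N _ n).1 hn
  obtain ⟨j, hj, hjB⟩ := hittingAfter_le_iff.1 h1
  rcases hj.2.eq_or_lt with rfl | hlt
  · exact hjB
  · exact hB (h3 j hlt (hittingAfter_le_of_mem (Nat.zero_le _) hjB)).le hjB

/-- A visit to `B` is not earlier than the entrance time, and a record from `0` is a record from any
later starting time. -/
lemma mem_recsFrom_hitting {B : Set ℝ} {y : ℝ} {ω : Ω}
    (hω : ∀ n, ∃ k, n < k ∧ chain X y n ω < chain X y k ω) {N n : ℕ}
    (hn : n ∈ recsFrom X y N (fun _ => ((0 : ℕ) : WithTop ℕ)) ω) (hB : chain X y n ω ∈ B) :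
    n ∈ recsFrom X y N (hittingAfter (chain X y) B 0) ω := by
  obtain ⟨_, h2, h3⟩ := (mem_recsFrom_iff hω N _ n).1 hn
  exact (mem_recsFrom_iff hω N _ n).2
    ⟨hittingAfter_le_of_mem (Nat.zero_le _) hB, h2, fun i hi _ => h3 i hi (by simp)⟩

lemma isStoppingTime_hitting (hX : ∀ i, Measurable (X i)) (y : ℝ) {B : Set ℝ}
    (hB : MeasurableSet B) :
    IsStoppingTime (walkFiltration X hX) (hittingAfter (chain X y) B 0) :=
  Adapted.isStoppingTime_hittingAfter
    (fun _ => measurable_chain_filtration X hX y le_rfl) hB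

/-- Truncated at a record time, the first entrance time into `B` has the smallest mean loss. -/
lemma lintegral_loss_truncTime_le (H : ClimbingWalk P X) {γ : ℝ → ℝ} (hγ : Monotone γ) {c : ℝ}
    (hc : 0 ≤ c) (hm0 : meanIdx P X ≠ 0) (hm : meanIdx P X ≠ ⊤) {B : Set ℝ} (hB : IsUpperSet B)
    (hBm : MeasurableSet B)
    (hmono : Monotone fun z => ENNReal.ofReal c * meanIdx P X - gain P X γ z)
    (hoff : ∀ z ∉ B, ENNReal.ofReal c * meanIdx P X ≤ gain P X γ z)
    (hon : ∀ z ∈ B, gain P X γ z ≤ ENNReal.ofReal c * meanIdx P X)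
    (y : ℝ) (N : ℕ) {τ : Ω → WithTop ℕ} (hτ : IsStoppingTime (walkFiltration X H.meas) τ)
    {Z : Ω → ℝ} (hZ : Measurable Z)
    (hZp : ∀ᵐ ω ∂P, ∀ n, payoff γ (fun _ => c) X y n ω ≤ Z ω) :
    ∫⁻ ω, loss Z γ c X y (truncTime X y N (hittingAfter (chain X y) B 0) ω) ω ∂P ≤
      ∫⁻ ω, loss Z γ c X y (truncTime X y N τ ω) ω ∂P := by
  set C := ENNReal.ofReal c * meanIdx P X with hC
  set m := meanIdx P X with hmdef
  let w : ℝ → ℝ≥0∞ := fun z => C - gain P X γ z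
  have hτB := isStoppingTime_hitting H.meas y hBm
  set τB := hittingAfter (chain X y) B 0
  have hτ0 : IsStoppingTime (walkFiltration X H.meas) fun _ => ((0 : ℕ) : WithTop ℕ) :=
    isStoppingTime_const _ 0
  have hgm : ∀ n, Measurable fun ω => gain P X γ (chain X y n ω) := fun n =>
    (measurable_gain hγ H.meas).comp (measurable_chain H.meas y n)
  have hwm : ∀ n, Measurable fun ω => w (chain X y n ω) := fun n =>
    hmono.measurable.comp (measurable_chain H.meas y n)
  have hbal := fun {τ} (hτ : IsStoppingTime (walkFiltration X H.meas) τ) =>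
    lintegral_loss_balance H hγ hc y N hτ hZ hZp
  have hfin : ∀ {τ}, IsStoppingTime (walkFiltration X H.meas) τ →
      ∫⁻ ω, ∑ _n ∈ recsFrom X y N τ ω, C ∂P ≠ ⊤ := by
    intro τ hτ
    have h1 : ∫⁻ ω, ∑ _n ∈ recsFrom X y N τ ω, m ∂P ≤ N * m := by
      rw [hmdef, ← lintegral_recTime_sub H y N hτ]
      refine le_trans (lintegral_mono fun ω => ?_) (lintegral_recTime_le H y N)
      exact Nat.cast_le.2 (Nat.sub_le _ _)
    simp_rw [hC, ← Finset.mul_sum]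
    rw [lintegral_const_mul' _ _ ENNReal.ofReal_ne_top]
    exact ENNReal.mul_ne_top ENNReal.ofReal_ne_top
      (h1.trans_lt (ENNReal.mul_lt_top (ENNReal.natCast_lt_top N) hm.lt_top)).ne
  -- Weighting by block length, divided by its mean, leaves the expectation unchanged and brings the
  -- sum into the form of `sum_recs_mul_le`.
  have hw_eq : ∀ {τ}, IsStoppingTime (walkFiltration X H.meas) τ →
      ∫⁻ ω, ∑ n ∈ recsFrom X y N τ ω, ((nextRec (fun k => chain X y k ω) n - n : ℕ) : ℝ≥0∞) *
        (w (chain X y n ω) / m) ∂P = ∫⁻ ω, ∑ n ∈ recsFrom X y N τ ω, w (chain X y n ω) ∂P := by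
    intro τ hτ
    rw [lintegral_sum_nextRec_mul H y N hτ (w := fun z => w z / m)
      (hmono.measurable.div_const m)]
    refine lintegral_congr fun ω => Finset.sum_congr rfl fun n _ => ?_
    exact ENNReal.mul_div_cancel hm0 hm
  have hwC : ∀ z, w z ≤ C := fun z => tsub_le_self
  have hsumadd : ∀ {τ}, IsStoppingTime (walkFiltration X H.meas) τ →
      ∫⁻ ω, ∑ n ∈ recsFrom X y N τ ω, (gain P X γ (chain X y n ω) + w (chain X y n ω)) ∂P =
      ∫⁻ ω, ∑ n ∈ recsFrom X y N τ ω, gain P X γ (chain X y n ω) ∂P +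
        ∫⁻ ω, ∑ n ∈ recsFrom X y N τ ω, w (chain X y n ω) ∂P := by
    intro τ hτ
    simp_rw [Finset.sum_add_distrib]
    exact lintegral_add_left' (aemeasurable_sum_recsFrom H y N hτ hgm) _
  have hB1 : ∫⁻ ω, ∑ _n ∈ recsFrom X y N τB ω, C ∂P =
      ∫⁻ ω, ∑ n ∈ recsFrom X y N τB ω, gain P X γ (chain X y n ω) ∂P +
        ∫⁻ ω, ∑ n ∈ recsFrom X y N τB ω, w (chain X y n ω) ∂P := by
    rw [← hsumadd hτB]
    refine lintegral_congr_ae ?_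
    filter_upwards [H.chain_climb y] with ω hω
    refine Finset.sum_congr rfl fun n hn => ?_
    exact (add_tsub_cancel_of_le (hon _ (chain_mem_of_mem_recsFrom hB hω hn))).symm
  have hBgain : ∫⁻ ω, ∑ n ∈ recsFrom X y N τB ω, gain P X γ (chain X y n ω) ∂P ≠ ⊤ := fun h =>
    hfin hτB (by rw [hB1, h, top_add])
  have hBw : ∫⁻ ω, ∑ n ∈ recsFrom X y N τB ω, w (chain X y n ω) ∂P ≠ ⊤ := fun h =>
    hfin hτB (by rw [hB1, h, add_top])
  -- On `B` one has `C = gain + w`, so the finite gain sum cancels from the balance.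
  have hB2 : ∫⁻ ω, loss Z γ c X y (truncTime X y N τB ω) ω ∂P +
      ∫⁻ ω, ∑ n ∈ recsFrom X y N τB ω, w (chain X y n ω) ∂P =
      ∫⁻ ω, loss Z γ c X y (recTime X y N ω) ω ∂P := by
    have h := hbal hτB
    rw [← hC, hB1, add_left_comm, add_comm, ] at h
    exact (ENNReal.add_left_inj hBgain).1 h
  by_cases htop : ∫⁻ ω, loss Z γ c X y (truncTime X y N τ ω) ω ∂P = ⊤
  · rw [htop]; exact le_top
  have hgain : ∫⁻ ω, ∑ n ∈ recsFrom X y N τ ω, gain P X γ (chain X y n ω) ∂P ≠ ⊤ := fun h => by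
    have h' := hbal hτ
    rw [h, add_top] at h'
    exact ENNReal.add_ne_top.2 ⟨htop, hfin hτ⟩ h'
  -- For general `τ` only `C ≤ gain + w` holds, since records may lie off `B`.
  have h2 : ∫⁻ ω, loss Z γ c X y (recTime X y N ω) ω ∂P ≤
      ∫⁻ ω, loss Z γ c X y (truncTime X y N τ ω) ω ∂P +
        ∫⁻ ω, ∑ n ∈ recsFrom X y N τ ω, w (chain X y n ω) ∂P := by
    refine (ENNReal.add_le_add_iff_right hgain).1 ?_
    rw [← hbal hτ, add_assoc, add_comm (∫⁻ ω, ∑ n ∈ recsFrom X y N τ ω, w (chain X y n ω) ∂P),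
      ← hsumadd hτ]
    gcongr
    exact le_add_tsub
  have h3 : ∫⁻ ω, ∑ n ∈ recsFrom X y N τ ω, w (chain X y n ω) ∂P ≤
      ∫⁻ ω, ∑ n ∈ recsFrom X y N τB ω, w (chain X y n ω) ∂P := by
    calc ∫⁻ ω, ∑ n ∈ recsFrom X y N τ ω, w (chain X y n ω) ∂P
        ≤ ∫⁻ ω, ∑ n ∈ recsFrom X y N (fun _ => ((0 : ℕ) : WithTop ℕ)) ω, w (chain X y n ω) ∂P := by
          rw [← hw_eq hτ, ← hw_eq hτ0]
          refine lintegral_mono_ae ?_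
          filter_upwards [H.chain_climb y] with ω hω
          have h0 : truncTime X y N (fun _ => ((0 : ℕ) : WithTop ℕ)) ω = 0 := by
            have := coe_truncTime X y N (fun _ => ((0 : ℕ) : WithTop ℕ)) ω
            simpa using this
          have := sum_recs_mul_le (w := fun z => w z / m)
            (fun a b hab => ENNReal.div_le_div_right (hmono hab) m) (fun k => chain X y k ω)
            (truncTime_le X y N τ ω) (recTime_isRec hω N).2
          simpa only [recsFrom, h0] using this
      _ ≤ _ := by
          refine lintegral_mono_ae ?_
          filter_upwards [H.chain_climb y] with ω hω
          refine Finset.sum_le_sum_of_ne_zero fun n hn hne => mem_recsFrom_hitting hω hn ?_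
          by_contra hc
          exact hne (tsub_eq_zero_of_le (hoff _ hc))
  refine (ENNReal.add_le_add_iff_right hBw).1 ?_
  rw [hB2]
  exact h2.trans (by gcongr)

end Comparison

/-! ### Removing the truncation -/

section Limit

variable {P : Measure Ω} [IsProbabilityMeasure P] {X : ℕ → Ω → ℝ}

/-- Both `v` and `u + s` are convex combinations of `u` and `v + s`, with the two weights swapped;
the two concavity inequalities add up to the claim. -/
lemma sub_le_sub_of_concaveOn {γ : ℝ → ℝ} {b : ℝ} (hconc : ConcaveOn ℝ (Set.Ici b) γ)
    {u v s : ℝ} (hu : b ≤ u) (huv : u ≤ v) (hs : 0 ≤ s) : γ (v + s) - γ v ≤ γ (u + s) - γ u := by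
  rcases (add_nonneg (sub_nonneg.2 huv) hs).eq_or_lt with h | h
  · have h1 : v = u := by linarith
    rw [h1]
  · set d := v - u + s with hd
    have e : s / d + (v - u) / d = 1 := by
      rw [← add_div, ← hd.trans (add_comm _ _)]
      exact div_self h.ne'
    have hp : 0 ≤ s / d := div_nonneg hs h.le
    have hq : 0 ≤ (v - u) / d := div_nonneg (by linarith) h.le
    have hmem : v + s ∈ Set.Ici b := by simp only [Set.mem_Ici]; linarith
    have h1 := hconc.2 (Set.mem_Ici.2 hu) hmem hp hq e
    have h2 := hconc.2 (Set.mem_Ici.2 hu) hmem hq hp (by rw [add_comm]; exact e)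
    simp only [smul_eq_mul] at h1 h2
    have e1 : s / d * u + (v - u) / d * (v + s) = v := by
      have : s / d = 1 - (v - u) / d := by linarith
      rw [this]
      have : (v - u) / d * d = v - u := div_mul_cancel₀ _ h.ne'
      rw [hd] at this ⊢
      linarith
    have e2 : (v - u) / d * u + s / d * (v + s) = u + s := by
      have : (v - u) / d = 1 - s / d := by linarith
      rw [this]
      have : s / d * d = s := div_mul_cancel₀ _ h.ne'
      rw [hd] at this ⊢
      linarith
    rw [e1] at h1
    rw [e2] at h2
    have e3 : s / d * γ u + (v - u) / d * γ u = γ u := by rw [← add_mul, e, one_mul]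
    have e4 : s / d * γ (v + s) + (v - u) / d * γ (v + s) = γ (v + s) := by
      rw [← add_mul, e, one_mul]
    linarith

/-- The largest further profit along a path when one starts in `b`. -/
noncomputable def maxProfit (γ : ℝ → ℝ) (c b : ℝ) (x : ℕ → ℝ) : ℝ≥0∞ :=
  ⨆ k : ℕ, ENNReal.ofReal (γ (b + psum x k) - γ b - c * k)

lemma measurable_maxProfit {γ : ℝ → ℝ} (hγ : Monotone γ) (c b : ℝ) :
    Measurable (maxProfit γ c b) :=
  Measurable.iSup fun k => ENNReal.measurable_ofReal.comp
    (((hγ.measurable.comp ((measurable_psum k).const_add b)).sub_const _).sub_const _)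

/-- From a start `z ≥ y`, the further profit is bounded in terms of the one from `b`. -/
lemma ofReal_profit_le {γ : ℝ → ℝ} (hγ : Monotone γ) {c b : ℝ} (hc : 0 ≤ c)
    (hconc : ConcaveOn ℝ (Set.Ici b) γ) {y z : ℝ} (hz : y ≤ z) (x : ℕ → ℝ) (k : ℕ) :
    ENNReal.ofReal (γ (z + psum x k) - γ z - c * k) ≤
      maxProfit γ c b x + ENNReal.ofReal (γ b - γ y) := by
  have hk : 0 ≤ c * k := by positivity
  rcases le_total (psum x k) 0 with hs | hs
  · have := hγ (show z + psum x k ≤ z by linarith)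
    rw [ENNReal.ofReal_of_nonpos (by linarith)]
    exact zero_le
  · refine le_trans ?_ (add_le_add_left (le_iSup (fun k : ℕ =>
      ENNReal.ofReal (γ (b + psum x k) - γ b - c * k)) k) _)
    rcases le_total b z with hb | hb
    · refine le_trans (ENNReal.ofReal_le_ofReal ?_) le_self_add
      have := sub_le_sub_of_concaveOn hconc le_rfl hb hs
      linarith
    · refine (ENNReal.ofReal_le_ofReal ?_).trans ENNReal.ofReal_add_le
      have h1 := hγ hz
      have h2 := hγ (show z + psum x k ≤ b + psum x k by linarith)
      linarith

/-- The loss of the random time `τ`; it is infinite where one never stops. -/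
noncomputable def stoppedLoss (Z : Ω → ℝ) (γ : ℝ → ℝ) (c : ℝ) (X : ℕ → Ω → ℝ) (y : ℝ)
    (τ : Ω → WithTop ℕ) (ω : Ω) : ℝ≥0∞ :=
  match τ ω with
  | ⊤ => ⊤
  | (n : ℕ) => loss Z γ c X y n ω

lemma stoppedLoss_top {Z : Ω → ℝ} {γ : ℝ → ℝ} {c y : ℝ} {τ : Ω → WithTop ℕ} {ω : Ω}
    (h : τ ω = ⊤) : stoppedLoss Z γ c X y τ ω = ⊤ := by
  simp [stoppedLoss, h]

lemma stoppedLoss_coe {Z : Ω → ℝ} {γ : ℝ → ℝ} {c y : ℝ} {τ : Ω → WithTop ℕ} {ω : Ω} {n : ℕ}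
    (h : τ ω = (n : WithTop ℕ)) : stoppedLoss Z γ c X y τ ω = loss Z γ c X y n ω := by
  unfold stoppedLoss
  rw [h]
  rfl

lemma truncTime_of_le {y : ℝ} {N n : ℕ} {τ : Ω → WithTop ℕ} {ω : Ω} (h : τ ω = (n : WithTop ℕ))
    (hn : n ≤ recTime X y N ω) : truncTime X y N τ ω = n := by
  have h1 := coe_truncTime X y N τ ω
  rw [h, min_eq_left (by exact_mod_cast hn)] at h1
  exact_mod_cast h1

lemma truncTime_of_ge {y : ℝ} {N : ℕ} {τ : Ω → WithTop ℕ} {ω : Ω}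
    (h : (recTime X y N ω : WithTop ℕ) ≤ τ ω) : truncTime X y N τ ω = recTime X y N ω := by
  have h1 := coe_truncTime X y N τ ω
  rw [min_eq_right h] at h1
  exact_mod_cast h1

/-- The event that `recTime X y N = n` and that `τ` comes later. -/
def lateEvent (X : ℕ → Ω → ℝ) (y : ℝ) (N : ℕ) (τ : Ω → WithTop ℕ) (n : ℕ) : Set Ω :=
  {ω | (N ≤ n ∧ IsRec (fun k => chain X y k ω) 0 n ∧
    ∀ k, N ≤ k → k < n → ¬ IsRec (fun k => chain X y k ω) 0 k) ∧ ¬ τ ω ≤ n}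

lemma measurableSet_lateEvent (hX : ∀ i, Measurable (X i)) (y : ℝ) (N : ℕ) {τ : Ω → WithTop ℕ}
    (hτ : IsStoppingTime (walkFiltration X hX) τ) (n : ℕ) :
    MeasurableSet[walkFiltration X hX n] (lateEvent X y N τ n) := by
  have h : MeasurableSet[walkFiltration X hX n]
      {ω | ∀ k, N ≤ k → k < n → ¬ IsRec (fun k => chain X y k ω) 0 k} := by
    have : {ω | ∀ k, N ≤ k → k < n → ¬ IsRec (fun k => chain X y k ω) 0 k} =
        ⋂ k, ⋂ (_ : N ≤ k), ⋂ (_ : k < n), {ω | IsRec (fun k => chain X y k ω) 0 k}ᶜ := by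
      ext; simp
    rw [this]
    exact MeasurableSet.iInter fun k => MeasurableSet.iInter fun _ =>
      MeasurableSet.iInter fun hk => (measurableSet_isRec X hX y hk.le).compl
  exact (MeasurableSet.inter (MeasurableSet.const _)
    ((measurableSet_isRec X hX y le_rfl).inter h)).inter (hτ n).compl

lemma mem_lateEvent_iff {y : ℝ} {ω : Ω}
    (hω : ∀ n, ∃ k, n < k ∧ chain X y n ω < chain X y k ω) (N : ℕ) (τ : Ω → WithTop ℕ) (n : ℕ) :
    ω ∈ lateEvent X y N τ n ↔ n = recTime X y N ω ∧ ¬ τ ω ≤ n := by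
  obtain ⟨h1, h2⟩ := recTime_isRec hω N
  rw [lateEvent, Set.mem_ofPred_eq]
  refine and_congr_left fun _ => ⟨fun ⟨h3, h4, h5⟩ => ?_, ?_⟩
  · apply le_antisymm
    · by_contra! hc
      exact h5 _ h1 hc h2
    · exact Nat.sInf_le (s := {n | N ≤ n ∧ IsRec (fun k => chain X y k ω) 0 n}) ⟨h3, h4⟩
  · rintro rfl
    exact ⟨h1, h2, fun k hk hkn hr => Nat.notMem_of_lt_sInf hkn ⟨hk, hr⟩⟩

lemma iInter_lt_stoppingTime (τ : Ω → WithTop ℕ) :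
    ⋂ N : ℕ, {ω | (N : WithTop ℕ) < τ ω} = {ω | τ ω = ⊤} := by
  ext ω
  simp only [Set.mem_iInter, Set.mem_ofPred_eq]
  constructor
  · intro h
    rcases hτω : τ ω with _ | k
    · rfl
    · have := h k
      rw [hτω] at this
      exact absurd this (lt_irrefl _)
  · intro h N
    rw [h]
    exact WithTop.coe_lt_top N

lemma measurableSet_lt_stoppingTime {hX : ∀ i, Measurable (X i)} {τ : Ω → WithTop ℕ}
    (hτ : IsStoppingTime (walkFiltration X hX) τ) (N : ℕ) :
    MeasurableSet {ω | (N : WithTop ℕ) < τ ω} :=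
  (walkFiltration X hX).le N _ (hτ.measurableSet_gt N)

lemma measurable_comp_stoppingTime {β : Type*} [MeasurableSpace β] {hX : ∀ i, Measurable (X i)}
    {τ : Ω → WithTop ℕ} (hτ : IsStoppingTime (walkFiltration X hX) τ) {F : WithTop ℕ → Ω → β}
    (hF : ∀ t, Measurable (F t)) : Measurable fun ω => F (τ ω) ω := by
  have hτm : Measurable τ := by
    refine measurable_to_countable' fun t => ?_
    cases t with
    | top =>
      have : τ ⁻¹' {⊤} = ⋂ N : ℕ, {ω | (N : WithTop ℕ) < τ ω} := by
        rw [iInter_lt_stoppingTime]; rfl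
      rw [this]
      exact MeasurableSet.iInter fun N => measurableSet_lt_stoppingTime hτ N
    | coe n => exact (walkFiltration X hX).le n _ (hτ.measurableSet_eq n)
  have h : Measurable fun q : WithTop ℕ × Ω => F q.1 q.2 :=
    measurable_from_prod_countable_right hF
  exact h.comp (hτm.prodMk measurable_id)

/-- The mean loss of the truncated time exceeds that of `τ` by at most a multiple of
`P (N < τ)`. -/
lemma lintegral_loss_truncTime_le_add (H : ClimbingWalk P X) {γ : ℝ → ℝ} (hγ : Monotone γ)
    {c b : ℝ} (hc : 0 ≤ c) (hconc : ConcaveOn ℝ (Set.Ici b) γ) (y : ℝ) (N : ℕ)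
    {τ : Ω → WithTop ℕ} (hτ : IsStoppingTime (walkFiltration X H.meas) τ) (Z : Ω → ℝ) :
    ∫⁻ ω, loss Z γ c X y (truncTime X y N τ ω) ω ∂P ≤ ∫⁻ ω, stoppedLoss Z γ c X y τ ω ∂P +
      (∫⁻ ω, (maxProfit γ c b (fun i => X i ω) + ENNReal.ofReal (γ b - γ y)) ∂P) *
        P {ω | (N : WithTop ℕ) < τ ω} := by
  classical
  let D : (ℕ → ℝ) → ℝ≥0∞ := fun x => maxProfit γ c b x + ENNReal.ofReal (γ b - γ y)
  have hD : Measurable D := (measurable_maxProfit hγ c b).add_const _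
  have hsh : ∀ n, Measurable fun ω i => X (n + i) ω := fun n => measurable_pi_iff.2 fun i => H.meas _
  have hmeas : ∀ n, MeasurableSet (lateEvent X y N τ n) := fun n =>
    (walkFiltration X H.meas).le n _ (measurableSet_lateEvent H.meas y N hτ n)
  have hDm : ∀ n, Measurable ((lateEvent X y N τ n).indicator fun ω => D fun i => X (n + i) ω) :=
    fun n => (hD.comp (hsh n)).indicator (hmeas n)
  set κ := ∫⁻ ω, D (fun i => X i ω) ∂P
  calc ∫⁻ ω, loss Z γ c X y (truncTime X y N τ ω) ω ∂P
      ≤ ∫⁻ ω, (stoppedLoss Z γ c X y τ ω +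
          ∑' n, (lateEvent X y N τ n).indicator (fun ω => D fun i => X (n + i) ω) ω) ∂P := by
        refine lintegral_mono_ae ?_
        filter_upwards [H.chain_climb y] with ω hω
        rcases hτω : τ ω with _ | k
        · rw [stoppedLoss_top hτω, top_add]; exact le_top
        · replace hτω : τ ω = (k : WithTop ℕ) := hτω
          rw [stoppedLoss_coe hτω]
          rcases le_or_gt k (recTime X y N ω) with hk | hk
          · rw [truncTime_of_le hτω hk]; exact le_self_add
          · have hlt : ¬ τ ω ≤ (recTime X y N ω : WithTop ℕ) := by
              rw [hτω, not_le]; exact_mod_cast hk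
            rw [truncTime_of_ge (not_le.1 hlt).le]
            have hmem := (mem_lateEvent_iff hω N τ _).2 ⟨rfl, hlt⟩
            refine le_trans ?_ (add_le_add_right (ENNReal.le_tsum (recTime X y N ω)) _)
            rw [Set.indicator_of_mem hmem]
            have hrec := (recTime_isRec hω N).2
            set T := recTime X y N ω
            obtain ⟨j, rfl⟩ := Nat.exists_eq_add_of_le hk.le
            -- A record counted from time `0` is at least the starting height; this makes the bound
            -- of `ofReal_profit_le` uniform in the height at time `T`.
            have hz : y ≤ chain X y T ω := by
              have h0 : chain X y 0 ω = y := by simp [chain, walk]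
              rcases Nat.eq_zero_or_pos T with hT | hT
              · rw [hT, h0]
              · exact h0.symm.le.trans (hrec 0 le_rfl hT).le
            refine le_trans ?_ (add_le_add_right
              (ofReal_profit_le hγ hc hconc hz (fun i => X (T + i) ω) j) _)
            rw [loss, loss]
            refine le_trans (ENNReal.ofReal_le_ofReal ?_) ENNReal.ofReal_add_le
            rw [payoff_const, payoff_const, chain_add]
            push_cast
            linarith
    _ = ∫⁻ ω, stoppedLoss Z γ c X y τ ω ∂P + ∫⁻ ω, ∑' n,
          (lateEvent X y N τ n).indicator (fun ω => D fun i => X (n + i) ω) ω ∂P :=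
        lintegral_add_right _ (Measurable.tsum hDm)
    _ = ∫⁻ ω, stoppedLoss Z γ c X y τ ω ∂P +
          ∫⁻ ω, ∑' n, (lateEvent X y N τ n).indicator (fun _ => κ) ω ∂P := by
        congr 1
        rw [lintegral_tsum fun n => (hDm n).aemeasurable,
          lintegral_tsum fun n => (measurable_const.indicator (hmeas n)).aemeasurable]
        exact tsum_congr fun n => lintegral_indicator_markov P H.meas H.indep H.ident y n
          (measurableSet_lateEvent H.meas y N hτ n) (K := fun _ x => D x) (hD.comp measurable_snd)
    _ ≤ ∫⁻ ω, stoppedLoss Z γ c X y τ ω ∂P +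
          ∫⁻ ω, {ω | (N : WithTop ℕ) < τ ω}.indicator (fun _ => κ) ω ∂P := by
        refine add_le_add_right (lintegral_mono_ae ?_) _
        filter_upwards [H.chain_climb y] with ω hω
        -- The late events are disjoint, and each forces `N ≤ recTime < τ`.
        rw [tsum_eq_single (recTime X y N ω)]
        · by_cases h : ω ∈ lateEvent X y N τ (recTime X y N ω)
          · have h1 := not_le.1 ((mem_lateEvent_iff hω N τ _).1 h).2
            have h2 : ω ∈ {ω | (N : WithTop ℕ) < τ ω} :=
              lt_of_le_of_lt (by exact_mod_cast (recTime_isRec hω N).1) h1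
            rw [Set.indicator_of_mem h, Set.indicator_of_mem h2]
          · rw [Set.indicator_of_notMem h]
            exact zero_le
        · intro n hn
          exact Set.indicator_of_notMem (fun h => hn ((mem_lateEvent_iff hω N τ n).1 h).1) _
    _ = _ := by
        congr 1
        rw [lintegral_indicator (measurableSet_lt_stoppingTime hτ N), lintegral_const,
          Measure.restrict_apply_univ]

lemma tendsto_measure_lt_stoppingTime {hX : ∀ i, Measurable (X i)} {τ : Ω → WithTop ℕ}
    (hτ : IsStoppingTime (walkFiltration X hX) τ) (htop : P {ω | τ ω = ⊤} = 0) :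
    Tendsto (fun N : ℕ => P {ω | (N : WithTop ℕ) < τ ω}) atTop (𝓝 0) := by
  have h := tendsto_measure_iInter_atTop (μ := P) (s := fun N : ℕ => {ω | (N : WithTop ℕ) < τ ω})
    (fun N => (measurableSet_lt_stoppingTime hτ N).nullMeasurableSet)
    (fun a b hab ω (hω : (b : WithTop ℕ) < τ ω) =>
      lt_of_le_of_lt (show (a : WithTop ℕ) ≤ b by exact_mod_cast hab) hω) ⟨0, measure_ne_top _ _⟩
  rwa [iInter_lt_stoppingTime τ, htop] at h

/-- If `τ` is finite the sequence is eventually constant; otherwise the truncated times tend to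
infinity and the payoffs to `-∞`. -/
lemma tendsto_loss_truncTime {Z : Ω → ℝ} {γ : ℝ → ℝ} {c y : ℝ} {ω : Ω}
    (hω : ∀ n, ∃ k, n < k ∧ chain X y n ω < chain X y k ω)
    (hlim : Tendsto (fun n : ℕ => payoff γ (fun _ => c) X y n ω) atTop atBot)
    (τ : Ω → WithTop ℕ) :
    Tendsto (fun N => loss Z γ c X y (truncTime X y N τ ω) ω) atTop
      (𝓝 (stoppedLoss Z γ c X y τ ω)) := by
  rcases hτω : τ ω with _ | k
  · rw [stoppedLoss_top hτω]
    have h1 : Tendsto (fun N => recTime X y N ω) atTop atTop :=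
      tendsto_atTop_mono (fun N => (recTime_isRec hω N).1) tendsto_id
    have h2 : ∀ N, truncTime X y N τ ω = recTime X y N ω := fun N =>
      truncTime_of_ge (by rw [hτω]; exact le_top)
    simp only [h2, loss]
    refine ENNReal.tendsto_ofReal_atTop.comp ?_
    simp only [sub_eq_add_neg]
    exact tendsto_atTop_add_const_left _ _ (tendsto_neg_atBot_atTop.comp (hlim.comp h1))
  · replace hτω : τ ω = (k : WithTop ℕ) := hτω
    rw [stoppedLoss_coe hτω]
    refine tendsto_const_nhds.congr' ?_
    filter_upwards [eventually_ge_atTop k] with N hN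
    rw [truncTime_of_le hτω (hN.trans (recTime_isRec hω N).1)]

/-- The first entrance time into `B` has the smallest mean loss among all stopping times. -/
theorem lintegral_stoppedLoss_le (H : ClimbingWalk P X) {γ : ℝ → ℝ} (hγ : Monotone γ) {c b : ℝ}
    (hc : 0 ≤ c) (hm0 : meanIdx P X ≠ 0) (hm : meanIdx P X ≠ ⊤) {B : Set ℝ} (hB : IsUpperSet B)
    (hBm : MeasurableSet B)
    (hmono : Monotone fun z => ENNReal.ofReal c * meanIdx P X - gain P X γ z)
    (hoff : ∀ z ∉ B, ENNReal.ofReal c * meanIdx P X ≤ gain P X γ z)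
    (hon : ∀ z ∈ B, gain P X γ z ≤ ENNReal.ofReal c * meanIdx P X)
    (hconc : ConcaveOn ℝ (Set.Ici b) γ)
    (hprofit : ∫⁻ ω, maxProfit γ c b (fun i => X i ω) ∂P ≠ ⊤)
    (y : ℝ) (hlim : ∀ᵐ ω ∂P, Tendsto (fun n : ℕ => payoff γ (fun _ => c) X y n ω) atTop atBot)
    {τ : Ω → WithTop ℕ} (hτ : IsStoppingTime (walkFiltration X H.meas) τ)
    {Z : Ω → ℝ} (hZ : Measurable Z)
    (hZp : ∀ᵐ ω ∂P, ∀ n, payoff γ (fun _ => c) X y n ω ≤ Z ω) :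
    ∫⁻ ω, stoppedLoss Z γ c X y (hittingAfter (chain X y) B 0) ω ∂P ≤
      ∫⁻ ω, stoppedLoss Z γ c X y τ ω ∂P := by
  -- A time that is infinite with positive probability has infinite mean loss, so only almost surely
  -- finite `τ` compete.
  by_cases htop : P {ω | τ ω = ⊤} = 0
  · have hτB := isStoppingTime_hitting H.meas y hBm
    set τB := hittingAfter (chain X y) B 0
    set κ := ∫⁻ ω, (maxProfit γ c b (fun i => X i ω) + ENNReal.ofReal (γ b - γ y)) ∂P with hκdef
    have hκ : κ ≠ ⊤ := by
      rw [hκdef, lintegral_add_right _ measurable_const]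
      simpa using hprofit
    have hle : ∀ N, ∫⁻ ω, loss Z γ c X y (truncTime X y N τB ω) ω ∂P ≤
        ∫⁻ ω, stoppedLoss Z γ c X y τ ω ∂P + κ * P {ω | (N : WithTop ℕ) < τ ω} := fun N =>
      (lintegral_loss_truncTime_le H hγ hc hm0 hm hB hBm hmono hoff hon y N hτ hZ hZp).trans
        (lintegral_loss_truncTime_le_add H hγ hc hconc y N hτ Z)
    have hlimN : Tendsto (fun N : ℕ => ∫⁻ ω, stoppedLoss Z γ c X y τ ω ∂P +
        κ * P {ω | (N : WithTop ℕ) < τ ω}) atTop (𝓝 (∫⁻ ω, stoppedLoss Z γ c X y τ ω ∂P)) := by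
      have := (ENNReal.Tendsto.const_mul (tendsto_measure_lt_stoppingTime (P := P) hτ htop)
        (Or.inr hκ)).const_add (∫⁻ ω, stoppedLoss Z γ c X y τ ω ∂P)
      simpa using this
    calc ∫⁻ ω, stoppedLoss Z γ c X y τB ω ∂P
        = ∫⁻ ω, liminf (fun N => loss Z γ c X y (truncTime X y N τB ω) ω) atTop ∂P := by
          refine lintegral_congr_ae ?_
          filter_upwards [H.chain_climb y, hlim] with ω hω hl
          exact (tendsto_loss_truncTime hω hl τB).liminf_eq.symm
      _ ≤ liminf (fun N => ∫⁻ ω, loss Z γ c X y (truncTime X y N τB ω) ω ∂P) atTop :=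
          lintegral_liminf_le fun N =>
            measurable_loss_comp hZ hγ c H.meas y (measurable_truncTime H.meas y N hτB)
      _ ≤ liminf (fun N : ℕ => ∫⁻ ω, stoppedLoss Z γ c X y τ ω ∂P +
            κ * P {ω | (N : WithTop ℕ) < τ ω}) atTop :=
          liminf_le_liminf (Eventually.of_forall hle)
      _ = ∫⁻ ω, stoppedLoss Z γ c X y τ ω ∂P := hlimN.liminf_eq
  · have : ∫⁻ ω, stoppedLoss Z γ c X y τ ω ∂P = ⊤ := by
      have hm : MeasurableSet {ω | τ ω = ⊤} := by
        rw [← iInter_lt_stoppingTime]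
        exact MeasurableSet.iInter fun N => measurableSet_lt_stoppingTime hτ N
      refine top_le_iff.1 ?_
      calc (⊤ : ℝ≥0∞) = ⊤ * P {ω | τ ω = ⊤} := (ENNReal.top_mul htop).symm
        _ = ∫⁻ ω, {ω | τ ω = ⊤}.indicator (fun _ => ⊤) ω ∂P := by
            rw [lintegral_indicator hm, lintegral_const, Measure.restrict_apply_univ]
        _ ≤ _ := by
            refine lintegral_mono fun ω => ?_
            by_cases h : ω ∈ {ω | τ ω = ⊤}
            · rw [stoppedLoss_top h]; exact le_top
            · rw [Set.indicator_of_notMem h]; exact zero_le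
    rw [this]; exact le_top

end Limit

/-! ### From mean losses back to expected payoffs -/

section Expectation

variable {P : Measure Ω} [IsProbabilityMeasure P] {X : ℕ → Ω → ℝ}

lemma stoppedPayoff_top {γ h : ℝ → ℝ} {y : ℝ} {τ : Ω → WithTop ℕ} {ω : Ω} (hω : τ ω = ⊤) :
    stoppedPayoff γ h X y τ ω = ⊥ := by
  unfold stoppedPayoff
  rw [hω]

lemma stoppedPayoff_coe {γ h : ℝ → ℝ} {y : ℝ} {τ : Ω → WithTop ℕ} {ω : Ω} {n : ℕ}
    (hω : τ ω = (n : WithTop ℕ)) : stoppedPayoff γ h X y τ ω = (payoff γ h X y n ω : EReal) := by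
  unfold stoppedPayoff
  rw [hω]
  rfl

/-- This is `p + (z - p) = z`, with `p` and `z` split into positive and negative parts and no
subtraction of the parts left. -/
lemma ofReal_add_ofReal_neg_add {p z : ℝ} (h : p ≤ z) :
    ENNReal.ofReal p + (ENNReal.ofReal (-z) + ENNReal.ofReal (z - p)) =
      ENNReal.ofReal (-p) + ENNReal.ofReal z := by
  rcases le_total 0 p with hp | hp
  · rw [ENNReal.ofReal_of_nonpos (show -z ≤ 0 by linarith),
      ENNReal.ofReal_of_nonpos (show -p ≤ 0 by linarith), zero_add, zero_add,
      ← ENNReal.ofReal_add hp (by linarith)]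
    congr 1; ring
  · rw [ENNReal.ofReal_of_nonpos hp, zero_add]
    rcases le_total 0 z with hz | hz
    · rw [ENNReal.ofReal_of_nonpos (show -z ≤ 0 by linarith), zero_add,
        ← ENNReal.ofReal_add (by linarith) hz]
      congr 1; ring
    · rw [ENNReal.ofReal_of_nonpos hz, add_zero, ← ENNReal.ofReal_add (by linarith) (by linarith)]
      congr 1; ring

lemma measurable_stoppedPayoff {γ : ℝ → ℝ} (hγ : Monotone γ) (c : ℝ) {hX : ∀ i, Measurable (X i)}
    (y : ℝ) {τ : Ω → WithTop ℕ} (hτ : IsStoppingTime (walkFiltration X hX) τ) :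
    Measurable (stoppedPayoff γ (fun _ => c) X y τ) := by
  refine measurable_comp_stoppingTime hτ (F := fun t ω =>
    stoppedPayoff γ (fun _ => c) X y (fun _ => t) ω) fun t => ?_
  cases t with
  | top => exact measurable_const
  | coe n => exact (measurable_payoff hγ c hX y n).coe_real_ereal

/-- The mean positive and negative parts of the payoff in terms of the mean loss. -/
lemma lintegral_stoppedPayoff_add {γ : ℝ → ℝ} (hγ : Monotone γ) (c : ℝ)
    {hX : ∀ i, Measurable (X i)} (y : ℝ) {τ : Ω → WithTop ℕ}
    (hτ : IsStoppingTime (walkFiltration X hX) τ) {Z : Ω → ℝ} (hZ : Measurable Z)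
    (hZp : ∀ᵐ ω ∂P, ∀ n, payoff γ (fun _ => c) X y n ω ≤ Z ω) :
    ∫⁻ ω, (stoppedPayoff γ (fun _ => c) X y τ ω).toENNReal ∂P +
        (∫⁻ ω, ENNReal.ofReal (-Z ω) ∂P + ∫⁻ ω, stoppedLoss Z γ c X y τ ω ∂P) =
      ∫⁻ ω, (-stoppedPayoff γ (fun _ => c) X y τ ω).toENNReal ∂P +
        ∫⁻ ω, ENNReal.ofReal (Z ω) ∂P := by
  have hZ' : Measurable fun ω => ENNReal.ofReal (-Z ω) := hZ.neg.ennreal_ofReal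
  rw [← lintegral_add_left hZ', ← lintegral_add_left
    (measurable_stoppedPayoff hγ c y hτ).ereal_toENNReal,
    ← lintegral_add_right _ hZ.ennreal_ofReal]
  refine lintegral_congr_ae ?_
  filter_upwards [hZp] with ω hω
  rcases hτω : τ ω with _ | n
  · simp [stoppedLoss_top hτω, stoppedPayoff_top hτω]
  · replace hτω : τ ω = (n : WithTop ℕ) := hτω
    rw [stoppedLoss_coe hτω, stoppedPayoff_coe hτω, ← EReal.coe_neg, EReal.real_coe_toENNReal,
      EReal.real_coe_toENNReal, loss]
    exact ofReal_add_ofReal_neg_add (hω n)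

/-- Formally `a - b = v - u - l`, which decreases in `l`. Only `b`, `b'` and the losses may be
infinite; `b = ⊤` makes the left side `-∞`, and otherwise all terms are finite. -/
lemma coe_sub_coe_le_of_balance {a b a' b' u v l l' : ℝ≥0∞} (h : a + (u + l) = b + v)
    (h' : a' + (u + l') = b' + v) (hl : l' ≤ l) (hu : u ≠ ⊤) (hv : v ≠ ⊤) (ha : a ≠ ⊤)
    (ha' : a' ≠ ⊤) : (a : EReal) - b ≤ (a' : EReal) - b' := by
  by_cases hb : b = ⊤
  · lift a to NNReal using ha
    rw [hb]
    simp
  · have hl1 : l ≠ ⊤ := by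
      rintro rfl
      rw [add_top, add_top] at h
      exact ENNReal.add_ne_top.2 ⟨hb, hv⟩ h.symm
    have hl2 : l' ≠ ⊤ := (hl.trans_lt hl1.lt_top).ne
    have hb' : b' ≠ ⊤ := by
      rintro rfl
      rw [top_add] at h'
      exact ENNReal.add_ne_top.2 ⟨ha', ENNReal.add_ne_top.2 ⟨hu, hl2⟩⟩ h'
    lift a to NNReal using ha
    lift b to NNReal using hb
    lift a' to NNReal using ha'
    lift b' to NNReal using hb'
    lift u to NNReal using hu
    lift v to NNReal using hv
    lift l to NNReal using hl1
    lift l' to NNReal using hl2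
    norm_cast at h h' hl
    have e : (a : ℝ) + (u + l) = b + v := by exact_mod_cast h
    have e' : (a' : ℝ) + (u + l') = b' + v := by exact_mod_cast h'
    have e2 : (l' : ℝ) ≤ l := by exact_mod_cast hl
    show ((a : ℝ) : EReal) - ((b : ℝ) : EReal) ≤ ((a' : ℝ) : EReal) - ((b' : ℝ) : EReal)
    rw [← EReal.coe_sub, ← EReal.coe_sub, EReal.coe_le_coe_iff]
    linarith

/-- The pathwise supremum of the payoffs. -/
noncomputable def supPayoff (γ : ℝ → ℝ) (c : ℝ) (X : ℕ → Ω → ℝ) (y : ℝ) (ω : Ω) : EReal :=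
  ⨆ n : ℕ, (payoff γ (fun _ => c) X y n ω : EReal)

lemma payoff_le_supPayoff (γ : ℝ → ℝ) (c : ℝ) (X : ℕ → Ω → ℝ) (y : ℝ) (n : ℕ) (ω : Ω) :
    (payoff γ (fun _ => c) X y n ω : EReal) ≤ supPayoff γ c X y ω :=
  le_iSup (fun n : ℕ => (payoff γ (fun _ => c) X y n ω : EReal)) n

lemma measurable_supPayoff {γ : ℝ → ℝ} (hγ : Monotone γ) (c : ℝ) (hX : ∀ i, Measurable (X i))
    (y : ℝ) : Measurable (supPayoff γ c X y) :=
  Measurable.iSup fun n => (measurable_payoff hγ c hX y n).coe_real_ereal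

lemma le_supPayoff (γ : ℝ → ℝ) (c : ℝ) (X : ℕ → Ω → ℝ) (y : ℝ) (ω : Ω) :
    (γ y : EReal) ≤ supPayoff γ c X y ω := by
  have h := payoff_le_supPayoff γ c X y 0 ω
  simpa [payoff, chain, walk] using h

/-- The time-zero payoff `γ y` bounds the supremum from below, so the negative part is integrable
and a mean below `⊤` forces the positive part to be integrable. -/
lemma lintegral_supPayoff_ne_top {γ : ℝ → ℝ} {c : ℝ} (hA : StandardAssumption P γ (fun _ => c) X)
    (y : ℝ) : ∫⁻ ω, (supPayoff γ c X y ω).toENNReal ∂P ≠ ⊤ := by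
  intro htop
  have h := hA.1 y
  have hneg : ∫⁻ ω, (-supPayoff γ c X y ω).toENNReal ∂P ≠ ⊤ := by
    refine ne_of_lt (lt_of_le_of_lt (lintegral_mono (g := fun _ => ENNReal.ofReal (-γ y))
      fun ω => ?_) (by simp))
    rw [← EReal.real_coe_toENNReal, EReal.coe_neg]
    exact EReal.toENNReal_le_toENNReal (EReal.neg_le_neg_iff.2 (le_supPayoff γ c X y ω))
  change ((∫⁻ ω, (supPayoff γ c X y ω).toENNReal ∂P : ℝ≥0∞) : EReal) -
    ((∫⁻ ω, (-supPayoff γ c X y ω).toENNReal ∂P : ℝ≥0∞) : EReal) < ⊤ at h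
  rw [htop] at h
  lift (∫⁻ ω, (-supPayoff γ c X y ω).toENNReal ∂P) to NNReal using hneg with r
  exact absurd h (by simp)

lemma ae_coe_toReal_supPayoff {γ : ℝ → ℝ} (hγ : Monotone γ) {c : ℝ} (hX : ∀ i, Measurable (X i))
    (hA : StandardAssumption P γ (fun _ => c) X) (y : ℝ) :
    ∀ᵐ ω ∂P, ((supPayoff γ c X y ω).toReal : EReal) = supPayoff γ c X y ω := by
  filter_upwards [ae_lt_top (measurable_supPayoff hγ c hX y).ereal_toENNReal
    (lintegral_supPayoff_ne_top hA y)] with ω hω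
  refine EReal.coe_toReal (EReal.toENNReal_ne_top_iff.1 hω.ne) ?_
  exact (lt_of_lt_of_le (EReal.bot_lt_coe _) (le_supPayoff γ c X y ω)).ne'

lemma expectation_stoppedPayoff_le {γ : ℝ → ℝ} (hγ : Monotone γ) {c : ℝ}
    {hX : ∀ i, Measurable (X i)} (hA : StandardAssumption P γ (fun _ => c) X) (y : ℝ)
    {σ τ : Ω → WithTop ℕ} (hσ : IsStoppingTime (walkFiltration X hX) σ)
    (hτ : IsStoppingTime (walkFiltration X hX) τ)
    (hle : ∫⁻ ω, stoppedLoss (fun ω => (supPayoff γ c X y ω).toReal) γ c X y σ ω ∂P ≤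
      ∫⁻ ω, stoppedLoss (fun ω => (supPayoff γ c X y ω).toReal) γ c X y τ ω ∂P) :
    expectation P (stoppedPayoff γ (fun _ => c) X y τ) ≤
      expectation P (stoppedPayoff γ (fun _ => c) X y σ) := by
  have hcoe := ae_coe_toReal_supPayoff hγ hX hA y
  have hZ : Measurable fun ω => (supPayoff γ c X y ω).toReal :=
    (measurable_supPayoff hγ c hX y).ereal_toReal
  have hZp : ∀ᵐ ω ∂P, ∀ n, payoff γ (fun _ => c) X y n ω ≤ (supPayoff γ c X y ω).toReal := by
    filter_upwards [hcoe] with ω hω n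
    rw [← EReal.coe_le_coe_iff, hω]
    exact payoff_le_supPayoff γ c X y n ω
  have hv : ∫⁻ ω, ENNReal.ofReal (supPayoff γ c X y ω).toReal ∂P ≠ ⊤ := by
    refine ne_of_eq_of_ne (lintegral_congr_ae ?_) (lintegral_supPayoff_ne_top hA y)
    filter_upwards [hcoe] with ω hω
    rw [← EReal.real_coe_toENNReal, hω]
  have hu : ∫⁻ ω, ENNReal.ofReal (-(supPayoff γ c X y ω).toReal) ∂P ≠ ⊤ := by
    refine ne_of_lt (lt_of_le_of_lt (lintegral_mono_ae (g := fun _ => ENNReal.ofReal (-γ y)) ?_)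
      (by simp))
    filter_upwards [hcoe] with ω hω
    refine ENNReal.ofReal_le_ofReal (neg_le_neg ?_)
    rw [← EReal.coe_le_coe_iff, hω]
    exact le_supPayoff γ c X y ω
  have hp : ∀ ρ : Ω → WithTop ℕ,
      ∫⁻ ω, (stoppedPayoff γ (fun _ => c) X y ρ ω).toENNReal ∂P ≠ ⊤ := by
    intro ρ
    refine ne_of_lt (lt_of_le_of_lt (lintegral_mono fun ω => EReal.toENNReal_le_toENNReal ?_)
      (lintegral_supPayoff_ne_top hA y).lt_top)
    rcases hρω : ρ ω with _ | n
    · rw [stoppedPayoff_top hρω]; exact bot_le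
    · rw [stoppedPayoff_coe (n := n) hρω]; exact payoff_le_supPayoff γ c X y n ω
  exact coe_sub_coe_le_of_balance (lintegral_stoppedPayoff_add hγ c y hτ hZ hZp)
    (lintegral_stoppedPayoff_add hγ c y hσ hZ hZp) hle hu hv (hp τ) (hp σ)

end Expectation

/-! ### Consequences of a finite mean ladder time; `gain`, `phi` and `f` -/

section Ladder

variable {P : Measure Ω} [IsProbabilityMeasure P] {X : ℕ → Ω → ℝ}

lemma ladderTime_eq {ω : Ω} (h : ladderTime X ω ≠ ⊤) :
    ladderTime X ω = ((ladderIdx fun i => X i ω : ℕ) : WithTop ℕ) ∧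
      0 < psum (fun i => X i ω) (ladderIdx fun i => X i ω) := by
  have hex : ∃ j, 0 ≤ j ∧ walk X j ω ∈ Set.Ioi (0 : ℝ) := by
    by_contra! hc
    exact h (hittingAfter_eq_top_iff.2 hc)
  have hset : {i : ℕ | 0 ≤ i ∧ walk X i ω ∈ Set.Ioi (0 : ℝ)} =
      {k | 0 < psum (fun i => X i ω) k} := by
    ext k; simp [walk, psum]
  constructor
  · rw [ladderTime, hittingAfter, if_pos hex, hset]
    rfl
  · obtain ⟨j, _, hj⟩ := hex
    exact Nat.sInf_mem (s := {k | 0 < psum (fun i => X i ω) k}) ⟨j, hj⟩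

lemma ae_ladderTime_ne_top (hX : ∀ i, Measurable (X i)) (h : meanLadderTime P X < ⊤) :
    ∀ᵐ ω ∂P, ladderTime X ω ≠ ⊤ := by
  have hst : IsStoppingTime (walkFiltration X hX) (ladderTime X) :=
    Adapted.isStoppingTime_hittingAfter (fun _ => measurable_walk_filtration X hX le_rfl)
      measurableSet_Ioi
  have hm : Measurable fun ω => ENat.toENNReal (ladderTime X ω) :=
    measurable_comp_stoppingTime hst (F := fun t _ => ENat.toENNReal t) fun _ => measurable_const
  filter_upwards [ae_lt_top hm h.ne] with ω hω htop
  rw [htop] at hω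
  exact absurd hω (by simp [show (⊤ : WithTop ℕ) = (⊤ : ℕ∞) from rfl])

lemma meanLadderTime_eq (hX : ∀ i, Measurable (X i)) (h : meanLadderTime P X < ⊤) :
    meanLadderTime P X = meanIdx P X := by
  refine lintegral_congr_ae ?_
  filter_upwards [ae_ladderTime_ne_top hX h] with ω hω
  rw [(ladderTime_eq hω).1]
  rfl

lemma climbingWalk_of_meanLadderTime (hX : ∀ i, Measurable (X i)) (hindep : iIndepFun X P)
    (hident : ∀ i, IdentDistrib (X i) (X 0) P P) (h : meanLadderTime P X < ⊤) :
    ClimbingWalk P X := by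
  refine ⟨hX, hindep, hident, ?_⟩
  rw [ae_all_iff]
  intro n
  have hX' : ∀ n, Measurable fun ω i => X (n + i) ω := fun n => measurable_pi_iff.2 fun i => hX _
  have hX0 : Measurable fun ω i => X i ω := measurable_pi_iff.2 hX
  have hS : MeasurableSet {x : ℕ → ℝ | 0 < psum x (ladderIdx x)} :=
    measurableSet_lt measurable_const measurable_psum_ladderIdx
  -- This encodes that some partial sum is positive: the default index `0` gives the sum `0`. Stated
  -- for the law of the increments, it transfers to the walk restarted at time `n`.
  have h0 : ∀ᵐ x ∂(P.map fun ω i => X i ω), 0 < psum x (ladderIdx x) := by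
    rw [ae_map_iff hX0.aemeasurable hS]
    filter_upwards [ae_ladderTime_ne_top hX h] with ω hω
    exact (ladderTime_eq hω).2
  rw [← map_shift_eq P hX hindep hident n, ae_map_iff (hX' n).aemeasurable hS] at h0
  filter_upwards [h0] with ω hω
  set k := ladderIdx fun i => X (n + i) ω with hk
  have hpos : 0 < psum (fun i => X (n + i) ω) k := hω
  refine ⟨n + k, ?_, ?_⟩
  · rcases Nat.eq_zero_or_pos k with h0 | h0
    · rw [h0] at hpos; simp [psum] at hpos
    · omega
  · have := chain_add X 0 n k ω
    simp only [chain, zero_add] at this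
    rw [this]
    linarith

lemma meanIdx_ne_zero (hX : ∀ i, Measurable (X i)) (h : meanLadderTime P X < ⊤) :
    meanIdx P X ≠ 0 := by
  have h1 : (1 : ℝ≥0∞) ≤ meanIdx P X := by
    calc (1 : ℝ≥0∞) = ∫⁻ _, 1 ∂P := by simp
      _ ≤ _ := by
        refine lintegral_mono_ae ?_
        filter_upwards [ae_ladderTime_ne_top hX h] with ω hω
        have hpos := (ladderTime_eq hω).2
        rcases Nat.eq_zero_or_pos (ladderIdx fun i => X i ω) with h0 | h0
        · rw [h0] at hpos; simp [psum] at hpos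
        · exact_mod_cast h0
  exact (lt_of_lt_of_le zero_lt_one h1).ne'

lemma chain_eq_add_psum (X : ℕ → Ω → ℝ) (y : ℝ) (k : ℕ) (ω : Ω) :
    chain X y k ω = y + psum (fun i => X i ω) k := rfl

/-- The integrand is the payoff at the ladder index plus `c` times that index minus `γ z`; the
payoff is below the supremum and the index has finite mean. -/
lemma gain_ne_top {γ : ℝ → ℝ} (hγ : Monotone γ) {c : ℝ} (hX : ∀ i, Measurable (X i))
    (hA : StandardAssumption P γ (fun _ => c) X) (hc : 0 ≤ c) (hm : meanIdx P X ≠ ⊤) (z : ℝ) :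
    gain P X γ z ≠ ⊤ := by
  have hS : Measurable fun ω => (supPayoff γ c X z ω).toENNReal :=
    (measurable_supPayoff hγ c hX z).ereal_toENNReal
  refine ne_of_lt (lt_of_le_of_lt (b := ∫⁻ ω, ((supPayoff γ c X z ω).toENNReal +
    (ENNReal.ofReal c * (ladderIdx fun i => X i ω : ℝ≥0∞) + ENNReal.ofReal (-γ z))) ∂P)
    (lintegral_mono fun ω => ?_) ?_)
  · have h1 := EReal.toENNReal_le_toENNReal
      (payoff_le_supPayoff γ c X z (ladderIdx fun i => X i ω) ω)
    rw [EReal.real_coe_toENNReal, payoff_const, chain_eq_add_psum] at h1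
    refine le_trans ?_ (add_le_add_left h1 _)
    rw [← ENNReal.ofReal_natCast, ← ENNReal.ofReal_mul hc]
    refine le_trans (le_of_eq ?_) (ENNReal.ofReal_add_le.trans
      (add_le_add_right ENNReal.ofReal_add_le _))
    congr 1
    ring
  · rw [lintegral_add_left hS, lintegral_add_right _ measurable_const,
      lintegral_const_mul' _ _ ENNReal.ofReal_ne_top]
    simp only [lintegral_const, measure_univ, mul_one]
    exact ENNReal.add_lt_top.2 ⟨(lintegral_supPayoff_ne_top hA z).lt_top, ENNReal.add_lt_top.2
      ⟨ENNReal.mul_lt_top ENNReal.ofReal_lt_top hm.lt_top, ENNReal.ofReal_lt_top⟩⟩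

lemma lintegral_maxProfit_ne_top {γ : ℝ → ℝ} {c : ℝ}
    (hA : StandardAssumption P γ (fun _ => c) X) (b : ℝ) :
    ∫⁻ ω, maxProfit γ c b (fun i => X i ω) ∂P ≠ ⊤ := by
  refine ne_of_lt (lt_of_le_of_lt (b := ∫⁻ ω, ((supPayoff γ c X b ω).toENNReal +
    ENNReal.ofReal (-γ b)) ∂P) (lintegral_mono fun ω => iSup_le fun k => ?_) ?_)
  · have h1 := EReal.toENNReal_le_toENNReal (payoff_le_supPayoff γ c X b k ω)
    rw [EReal.real_coe_toENNReal, payoff_const, chain_eq_add_psum] at h1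
    refine le_trans ?_ (add_le_add_left h1 _)
    refine le_trans (le_of_eq ?_) ENNReal.ofReal_add_le
    congr 1
    ring
  · rw [lintegral_add_right _ measurable_const]
    simpa using (lintegral_supPayoff_ne_top hA b).lt_top

lemma gain_antitoneOn {γ : ℝ → ℝ} {b : ℝ}
    (hconc : ConcaveOn ℝ (Set.Ici b) γ) : AntitoneOn (gain P X γ) (Set.Ici b) := by
  intro u hu v _ huv
  refine lintegral_mono fun ω => ENNReal.ofReal_le_ofReal ?_
  set x := fun i => X i ω
  have hs : 0 ≤ psum x (ladderIdx x) := by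
    by_cases h : ∃ k, 0 < psum x k
    · exact (Nat.sInf_mem (s := {k | 0 < psum x k}) h).le
    · have h0 : {k | 0 < psum x k} = ∅ := by
        ext k; simpa using not_lt.1 fun hk => h ⟨k, hk⟩
      rw [ladderIdx, h0, Nat.sInf_empty]
      simp [psum]
  exact sub_le_sub_of_concaveOn hconc hu huv hs

lemma stoppedValue_ladderTime {u : ℕ → Ω → ℝ} {ω : Ω} (h : ladderTime X ω ≠ ⊤) :
    stoppedValue u (ladderTime X) ω = u (ladderIdx fun i => X i ω) ω := by
  rw [stoppedValue, (ladderTime_eq h).1]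
  rfl

lemma measurable_gain_section {γ : ℝ → ℝ} (hγ : Monotone γ) (hX : ∀ i, Measurable (X i)) (y : ℝ) :
    Measurable fun ω => γ (y + psum (fun i => X i ω) (ladderIdx fun i => X i ω)) - γ y :=
  (hγ.measurable.comp
    ((measurable_psum_ladderIdx.comp (measurable_pi_iff.2 hX)).const_add y)).sub_const _

lemma ae_gain_nonneg {γ : ℝ → ℝ} (hγ : Monotone γ) (hX : ∀ i, Measurable (X i))
    (h : meanLadderTime P X < ⊤) (y : ℝ) :
    0 ≤ᵐ[P] fun ω => γ (y + psum (fun i => X i ω) (ladderIdx fun i => X i ω)) - γ y := by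
  filter_upwards [ae_ladderTime_ne_top hX h] with ω hω
  have := (ladderTime_eq hω).2
  exact sub_nonneg.2 (hγ (by linarith))

lemma integral_gain {γ : ℝ → ℝ} (hγ : Monotone γ) (hX : ∀ i, Measurable (X i))
    (h : meanLadderTime P X < ⊤) (y : ℝ) :
    ∫ ω, (γ (y + psum (fun i => X i ω) (ladderIdx fun i => X i ω)) - γ y) ∂P =
      (gain P X γ y).toReal :=
  integral_eq_lintegral_of_nonneg_ae (ae_gain_nonneg hγ hX h y)
    (measurable_gain_section hγ hX y).aestronglyMeasurable

lemma integral_sub_stoppedValue {γ : ℝ → ℝ} (hγ : Monotone γ) (hX : ∀ i, Measurable (X i))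
    (h : meanLadderTime P X < ⊤) (y : ℝ) :
    ∫ ω, (γ y - γ (y + stoppedValue (walk X) (ladderTime X) ω)) ∂P = -(gain P X γ y).toReal := by
  rw [← integral_gain hγ hX h, ← integral_neg]
  refine integral_congr_ae ?_
  filter_upwards [ae_ladderTime_ne_top hX h] with ω hω
  rw [stoppedValue_ladderTime hω, neg_sub]
  rfl

lemma phi_eq {γ : ℝ → ℝ} (hγ : Monotone γ) {c : ℝ} (hX : ∀ i, Measurable (X i))
    (h : meanLadderTime P X < ⊤) {y : ℝ} (hg : gain P X γ y ≠ ⊤) :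
    phi P γ (fun _ => c) X y =
      γ y + (gain P X γ y).toReal - c * (meanLadderTime P X).toReal := by
  have hl : Measurable fun ω => ((ladderIdx fun i => X i ω : ℕ) : ℝ) :=
    measurable_from_nat.comp (measurable_ladderIdx.comp (measurable_pi_iff.2 hX))
  have hlm : ∫⁻ ω, ENNReal.ofReal ((ladderIdx fun i => X i ω : ℕ) : ℝ) ∂P = meanIdx P X := by
    simp only [ENNReal.ofReal_natCast]; rfl
  have hl0 : 0 ≤ᵐ[P] fun ω => ((ladderIdx fun i => X i ω : ℕ) : ℝ) :=
    Eventually.of_forall fun ω => Nat.cast_nonneg _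
  have hli : Integrable (fun ω => ((ladderIdx fun i => X i ω : ℕ) : ℝ)) P :=
    ⟨hl.aestronglyMeasurable, (hasFiniteIntegral_iff_ofReal hl0).2 (by
      rw [hlm, ← meanLadderTime_eq hX h]; exact h)⟩
  have hgi : Integrable
      (fun ω => γ (y + psum (fun i => X i ω) (ladderIdx fun i => X i ω)) - γ y) P :=
    ⟨(measurable_gain_section hγ hX y).aestronglyMeasurable,
      (hasFiniteIntegral_iff_ofReal (ae_gain_nonneg hγ hX h y)).2 hg.lt_top⟩
  have hil : ∫ ω, ((ladderIdx fun i => X i ω : ℕ) : ℝ) ∂P = (meanLadderTime P X).toReal := by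
    rw [integral_eq_lintegral_of_nonneg_ae hl0 hl.aestronglyMeasurable, hlm,
      meanLadderTime_eq hX h]
  have hphi : phi P γ (fun _ => c) X y = ∫ ω, ((γ y +
      (γ (y + psum (fun i => X i ω) (ladderIdx fun i => X i ω)) - γ y)) -
        c * ((ladderIdx fun i => X i ω : ℕ) : ℝ)) ∂P := by
    refine integral_congr_ae ?_
    filter_upwards [ae_ladderTime_ne_top hX h] with ω hω
    rw [stoppedValue_ladderTime hω, payoff_const, chain_eq_add_psum]
    ring
  have hgi' : Integrable (fun ω => γ y +
      (γ (y + psum (fun i => X i ω) (ladderIdx fun i => X i ω)) - γ y)) P :=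
    (integrable_const _).add hgi
  rw [hphi, integral_sub hgi' (hli.const_mul c),
    integral_add (integrable_const _) hgi, integral_const_mul, hil, integral_gain hγ hX h]
  simp

lemma gain_le_iff {γ : ℝ → ℝ} {c : ℝ} (hc : 0 ≤ c) (hX : ∀ i, Measurable (X i))
    (h : meanLadderTime P X < ⊤) {y : ℝ} (hg : gain P X γ y ≠ ⊤) :
    gain P X γ y ≤ ENNReal.ofReal c * meanIdx P X ↔
      (gain P X γ y).toReal ≤ c * (meanLadderTime P X).toReal := by
  rw [← meanLadderTime_eq hX h, ← ENNReal.toReal_le_toReal hg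
    (ENNReal.mul_ne_top ENNReal.ofReal_ne_top h.ne), ENNReal.toReal_mul, ENNReal.toReal_ofReal hc]

/-- By `phi_eq`, the numerator of `f` is the gain minus the mean cost of one ladder block. -/
lemma f_nonpos_iff {γ : ℝ → ℝ} (hγ : Monotone γ) {c : ℝ} (hc : 0 ≤ c)
    (hX : ∀ i, Measurable (X i)) (h : meanLadderTime P X < ⊤) {y : ℝ}
    (hg : gain P X γ y ≠ ⊤) :
    f P γ (fun _ => c) X y ≤ 0 ↔ gain P X γ y ≤ ENNReal.ofReal c * meanIdx P X := by
  have hpos : 0 < (meanLadderTime P X).toReal :=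
    ENNReal.toReal_pos (by rw [meanLadderTime_eq hX h]; exact meanIdx_ne_zero hX h) h.ne
  rw [gain_le_iff hc hX h hg, f, phi_eq hγ hX h hg, div_nonpos_iff]
  constructor
  · rintro (⟨_, h2⟩ | ⟨h1, _⟩)
    · exact absurd hpos h2.not_gt
    · linarith
  · intro h1
    exact Or.inr ⟨by linarith, hpos.le⟩

end Ladder

/-! ### Optimality of entrance times into half-lines -/

section Main

variable {P : Measure Ω} [IsProbabilityMeasure P] {X : ℕ → Ω → ℝ}

/-- The first entrance time into an upper set `B` is optimal, if the mean profit up to the first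
ladder time is non-negative off `B` and non-positive on `B`. -/
theorem isOptimal_hittingAfter (hX : ∀ i, Measurable (X i)) (hindep : iIndepFun X P)
    (hident : ∀ i, IdentDistrib (X i) (X 0) P P) {γ : ℝ → ℝ} (hγ : Monotone γ) {c : ℝ}
    (hc : 0 ≤ c) (hA : StandardAssumption P γ (fun _ => c) X) (hladder : meanLadderTime P X < ⊤)
    {B : Set ℝ} (hB : IsUpperSet B) (hBm : MeasurableSet B)
    (hoff : ∀ z ∉ B, ENNReal.ofReal c * meanIdx P X ≤ gain P X γ z)
    (hon : ∀ z ∈ B, gain P X γ z ≤ ENNReal.ofReal c * meanIdx P X)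
    {b : ℝ} (hBb : B ⊆ Set.Ici b) (hconc : ConcaveOn ℝ (Set.Ici b) γ) (y : ℝ) :
    IsOptimal P γ (fun _ => c) X hX y (hittingAfter (chain X y) B 0) := by
  have H := climbingWalk_of_meanLadderTime hX hindep hident hladder
  have hm : meanIdx P X ≠ ⊤ := by
    rw [← meanLadderTime_eq hX hladder]; exact hladder.ne
  -- Truncated subtraction makes this zero off `B`; on the upper set `B` concavity gives
  -- monotonicity.
  have hmono : Monotone fun z => ENNReal.ofReal c * meanIdx P X - gain P X γ z := by
    intro u v huv
    by_cases hu : u ∈ B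
    · exact tsub_le_tsub_left
        (gain_antitoneOn hconc (hBb hu) (hBb (hB huv hu)) huv) _
    · show ENNReal.ofReal c * meanIdx P X - gain P X γ u ≤ _
      rw [tsub_eq_zero_of_le (hoff u hu)]
      exact zero_le
  have hτB := isStoppingTime_hitting hX y hBm
  refine ⟨hτB, le_antisymm (le_iSup₂_of_le _ hτB le_rfl) (iSup₂_le fun τ hτ => ?_)⟩
  refine expectation_stoppedPayoff_le hγ hA y hτB hτ ?_
  refine lintegral_stoppedLoss_le H hγ hc (meanIdx_ne_zero hX hladder) hm hB hBm hmono hoff hon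
    hconc (lintegral_maxProfit_ne_top hA b) y (hA.2 y) hτ
    (measurable_supPayoff hγ c hX y).ereal_toReal ?_
  filter_upwards [ae_coe_toReal_supPayoff hγ hX hA y] with ω hω n
  rw [← EReal.coe_le_coe_iff, hω]
  exact payoff_le_supPayoff γ c X y n ω

end Main

end WalkStopping

theorem mainTheorem6 {Ω : Type*} [MeasurableSpace Ω] (P : Measure Ω) [IsProbabilityMeasure P]
    (X : ℕ → Ω → ℝ) (hX : ∀ i, Measurable (X i))
    (hindep : iIndepFun X P) (hident : ∀ i, IdentDistrib (X i) (X 0) P P)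
    (hpos : 0 < P {ω | 0 < X 0 ω})
    (γ : ℝ → ℝ) (hγ : Monotone γ) (c : ℝ) (hc : 0 < c)
    (hA : WalkStopping.StandardAssumption P γ (fun _ => c) X)
    (hladder : WalkStopping.meanLadderTime P X < ⊤)
    (xbar : ℝ)
    (hxbar : IsGLB {y : ℝ |
      -c * (WalkStopping.meanLadderTime P X).toReal ≤
        ∫ ω, (γ y - γ (y + stoppedValue (WalkStopping.walk X) (WalkStopping.ladderTime X) ω)) ∂P}
      xbar)
    (hconc : ConcaveOn ℝ (Set.Ici xbar) γ) :
    (WalkStopping.f P γ (fun _ => c) X xbar ≤ 0 →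
      ∀ y : ℝ, WalkStopping.IsOptimal P γ (fun _ => c) X hX y
        (hittingAfter (WalkStopping.chain X y) (Set.Ici xbar) 0)) ∧
    (0 < WalkStopping.f P γ (fun _ => c) X xbar →
      ∀ y : ℝ, WalkStopping.IsOptimal P γ (fun _ => c) X hX y
        (hittingAfter (WalkStopping.chain X y) (Set.Ioi xbar) 0)) := by
  have hm : WalkStopping.meanIdx P X ≠ ⊤ := by
    rw [← WalkStopping.meanLadderTime_eq hX hladder]; exact hladder.ne
  have hg : ∀ z, WalkStopping.gain P X γ z ≠ ⊤ :=
    WalkStopping.gain_ne_top hγ hX hA hc.le hm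
  have hset : ∀ z, (-c * (WalkStopping.meanLadderTime P X).toReal ≤ ∫ ω, (γ z -
      γ (z + stoppedValue (WalkStopping.walk X) (WalkStopping.ladderTime X) ω)) ∂P) ↔
      WalkStopping.gain P X γ z ≤ ENNReal.ofReal c * WalkStopping.meanIdx P X := fun z => by
    rw [WalkStopping.integral_sub_stoppedValue hγ hX hladder,
      WalkStopping.gain_le_iff hc.le hX hladder (hg z), neg_mul, neg_le_neg_iff]
  have hlt : ∀ z < xbar,
      ENNReal.ofReal c * WalkStopping.meanIdx P X ≤ WalkStopping.gain P X γ z := fun z hz =>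
    (not_le.1 fun hle => hz.not_ge (hxbar.1 ((hset z).2 hle))).le
  have hgt : ∀ z, xbar < z →
      WalkStopping.gain P X γ z ≤ ENNReal.ofReal c * WalkStopping.meanIdx P X := fun z hz => by
    -- The defining set has a point `a` in `[xbar, z)`, and the gain decreases from `a` to `z`. The
    -- point `xbar` itself is left undecided; the sign of `f xbar` settles it.
    obtain ⟨a, ha, ha'⟩ := (isGLB_lt_iff hxbar).1 hz
    have hxa : xbar ≤ a := hxbar.1 ha
    exact (WalkStopping.gain_antitoneOn hconc hxa hz.le ha'.le).trans ((hset a).1 ha)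
  have hf := WalkStopping.f_nonpos_iff hγ hc.le hX hladder (hg xbar)
  constructor
  · intro h y
    refine WalkStopping.isOptimal_hittingAfter hX hindep hident hγ hc.le hA hladder
      (isUpperSet_Ici xbar) measurableSet_Ici (fun z hz => hlt z (not_le.1 hz)) (fun z hz => ?_)
      subset_rfl hconc y
    rcases (Set.mem_Ici.1 hz).eq_or_lt with rfl | hz
    · exact hf.1 h
    · exact hgt z hz
  · intro h y
    refine WalkStopping.isOptimal_hittingAfter hX hindep hident hγ hc.le hA hladder
      (isUpperSet_Ioi xbar) measurableSet_Ioi (fun z hz => ?_) (fun z hz => hgt z hz)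
      Set.Ioi_subset_Ici_self hconc y
    rcases (not_lt.1 (show ¬ xbar < z from hz)).eq_or_lt with rfl | hz
    · exact (not_le.1 fun hle => h.not_ge (hf.2 hle)).le
    · exact hlt z hz
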